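/- \textbf{Conventions.} For linearly independent $b_1,\dots,b_n\in\mathbb R^d$ (the rows of $B$) let $\mathcal L(b)$ be the lattice of their integer combinations, $\det\mathcal L=\sqrt{\det(BB^T)}$, $\widehat B=(BB^T)^{-1}B$ the dual basis (rows $\hat b_i$), and $\operatorname{gh}(\mathcal L)=\sqrt{n/(2\pi e)}\,\det(\mathcal L)^{1/n}$. A basis is HKZ-reduced if $n=1$, or if $b_1$ is a shortest nonzero vector of $\mathcal L(b)$, $|\langle b_1,b_i\rangle|\le\frac12\langle b_1,b_1\rangle$ for $i\ge2$, and the projections of $b_2,\dots,b_n$ on $b_1^\perp$ form an HKZ-reduced basis. LLL-reduction (factor $3/4$) of a finite generating system performs size-reductions, swaps of consecutive vectors violating Lovász' condition, and removals of zero vectors, in any order, until the system is an LLL-reduced basis. \textbf{Enumeration.} Fix $C>0$. On a basis $b$ of rank $n$, put $m_i=C\operatorname{gh}(\mathcal L(b))\,\|\hat b_i\|$ and $a_i=\lfloor m_i\rfloor$. Each integer $x_i\in[-a_i,a_i]$ is encoded by $\lfloor\log_2(2a_i)\rfloor+1$ binary variables (none if $a_i=0$) as $x_i=-a_i+\sum_{j<t}2^js_{ij}+(2a_i+1-2^{t})s_{it}$,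 $t=\lfloor\log_2(2a_i)\rfloor$. Replacing $s_{ij}$ by $(I-Z_{ij})/2$ in $x\,BB^T x^T$ gives a Hamiltonian; the (exact) enumeration returns the lattice vector of a computational basis state of lowest nonzero energy, or $0$ if there is none. Its number of qubits is counted as $$N(b)=\sum_{i=1}^n\bigl(\lfloor\log_2(2m_i)\rfloor+1\bigr).$$ \textbf{Algorithm.} Input: a basis $b_1,\dots,b_n$ of a lattice $\mathcal L$. If $n=1$, return it. Otherwise: (1) LLL-reduce the dual basis of $b$ to $d_1,\dots,d_n$; (2) recursively HKZ-reduce $(d_1,\dots,d_{n-1})$, keeping $d_n$; (3) replace $b$ by the dual basis of $(d_1,\dots,d_n)$; (4) run the enumeration on $b$ and let $v$ be its result; (5) LLL-reduce the system $(v,b_1,\dots,b_n)$ to a basis $(b_1,\dots,b_n)$; (6) recursively HKZ-reduce the projections of $b_2,\dots,b_n$ on $b_1^\perp$ to $b_2',\dots,b_n'$; (7) return $b_1$ and $b_i=b_i'+\alpha_ib_1$, $2\le i\le n$, where $\alpha_i\in(-\frac12,\frac12]$ is such that $b_i\in\mathcal L$. \textbf{Theorem.} Let $C>0$. (a) The algorithm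 has a terminating run on every basis of every lattice of rank $n\ge1$ in every $\mathbb R^d$. (b) Consider any run on a basis of a lattice $\mathcal L$ of rank $n\ge 1$ and assume the Gaussian heuristic with factor $C$ on it: for each basis $b$ on which the run (including its recursive calls) runs the enumeration, the ball of radius $C\operatorname{gh}(\mathcal L(b))$ contains a shortest nonzero vector of $\mathcal L(b)$. Then the output is an HKZ-reduced basis of $\mathcal L$. (c) There is a constant $K$ depending only on $C$ such that in each run as in (b), each enumeration has $$N\le \tfrac32 n\log_2 n-\bigl(\tfrac12\log_2\pi+\log_2e-\log_2C\bigr)n+K\log_2 n,$$ and, for $C=1$, $N\le\tfrac32 n\log_2n-2.26\,n+K\log_2 n$. Since the enumerations are run one after the other, this bounds the number of qubits used by the run. Moreover, for each enumeration with $m_i\ge\frac14$ for all $i$, the number of binary variables of the encoding is at most $N$. -/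

import Mathlib

noncomputable section

namespace QuantumHKZ

open InnerProductSpace Module

/-- The ambient Euclidean space `ℝ^d`. -/
abbrev Vec (d : ℕ) : Type := EuclideanSpace ℝ (Fin d)

variable {d : ℕ}

/-! ### Lattices -/

/-- The set `L(b₁, …, bₙ)` of all integer combinations of a family of vectors. -/
def lattice {n : ℕ} (b : Fin n → Vec d) : Submodule ℤ (Vec d) :=
  Submodule.span ℤ (Set.range b)

/-- The Gram matrix `B Bᵀ` of a family of vectors. -/
def gram {n : ℕ} (b : Fin n → Vec d) : Matrix (Fin n) (Fin n) ℝ :=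
  Matrix.of fun i j => inner ℝ (b i) (b j)

/-- The determinant (volume) of the lattice with basis `b`. -/
def latticeDet {n : ℕ} (b : Fin n → Vec d) : ℝ :=
  Real.sqrt (gram b).det

/-- The dual basis: the rows of `(B Bᵀ)⁻¹ B`. -/
def dualBasis {n : ℕ} (b : Fin n → Vec d) : Fin n → Vec d :=
  fun i => ∑ j, (gram b)⁻¹ i j • b j

/-- `v` is a shortest nonzero vector of `L`. -/
def IsShortest (L : Submodule ℤ (Vec d)) (v : Vec d) : Prop :=
  v ∈ L ∧ v ≠ 0 ∧ ∀ w ∈ L, w ≠ 0 → ‖v‖ ≤ ‖w‖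

/-- `gh(L) = √(n / (2πe)) · det(L)^(1/n)` for the lattice `L` with basis `b`. -/
def gh {n : ℕ} (b : Fin n → Vec d) : ℝ :=
  Real.sqrt ((n : ℝ) / (2 * Real.pi * Real.exp 1)) * latticeDet b ^ ((1 : ℝ) / (n : ℝ))

/-- The Gaussian heuristic with multiplicative factor `C` holds for the lattice with basis `b`:
the closed ball of radius `C · gh(L)` contains a shortest nonzero vector. -/
def GaussianHeuristic (C : ℝ) {n : ℕ} (b : Fin n → Vec d) : Prop :=
  ∃ v, IsShortest (lattice b) v ∧ ‖v‖ ≤ C * gh b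

/-- The orthogonal projection of `x` on `v^⊥`. -/
def projPerp (v x : Vec d) : Vec d :=
  (ℝ ∙ v)ᗮ.starProjection x

/-- HKZ-reducedness of a family `b₁, …, bₙ` (for linearly independent families). -/
def IsHKZ : {n : ℕ} → (Fin n → Vec d) → Prop
  | 0, _ => True
  | 1, _ => True
  | _ + 2, b =>
      IsShortest (lattice b) (b 0) ∧
      IsHKZ (fun i => projPerp (b 0) (b (Fin.succ i))) ∧
      ∀ i, |(inner ℝ (b 0) (b (Fin.succ i)) : ℝ)| ≤ 1 / 2 * |(inner ℝ (b 0) (b 0) : ℝ)|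

/-! ### The LLL algorithm -/

/-- The Gram–Schmidt coefficient `μ i j = ⟨bᵢ, bⱼ*⟩ / ‖bⱼ*‖²` (it is `0` when `bⱼ* = 0`). -/
def mu {n : ℕ} (b : Fin n → Vec d) (i j : Fin n) : ℝ :=
  (inner ℝ (b i) (gramSchmidt ℝ b j) : ℝ) / ‖gramSchmidt ℝ b j‖ ^ 2

/-- Lovász' condition, with the usual factor `3/4`, for the consecutive indices `i` and `j = i + 1`. -/
def Lovasz {n : ℕ} (b : Fin n → Vec d) (i j : Fin n) : Prop :=
  3 / 4 * ‖gramSchmidt ℝ b i‖ ^ 2 ≤ ‖gramSchmidt ℝ b j + mu b j i • gramSchmidt ℝ b i‖ ^ 2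

/-- `b` is an LLL-reduced basis. -/
def IsLLLReduced {n : ℕ} (b : Fin n → Vec d) : Prop :=
  LinearIndependent ℝ b ∧
  (∀ i j, j < i → |mu b i j| ≤ 1 / 2) ∧
  ∀ i j : Fin n, (j : ℕ) = (i : ℕ) + 1 → Lovasz b i j

/-- `LLLReduces c b`: the LLL algorithm, started on the finite system of vectors `b`
(possibly linearly dependent), stops with the basis `c`.  The algorithm performs size-reduction
steps, swaps of consecutive vectors that violate Lovász' condition, and removals of zero vectors,
until it has an LLL-reduced basis.  The order of the steps is left open. -/
inductive LLLReduces {n : ℕ} (c : Fin n → Vec d) : {m : ℕ} → (Fin m → Vec d) → Prop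
  | done : IsLLLReduced c → LLLReduces c c
  | sizeReduce {m : ℕ} (b : Fin m → Vec d) (i j : Fin m) :
      j < i → 1 / 2 < |mu b i j| →
      LLLReduces c (Function.update b i (b i - round (mu b i j) • b j)) → LLLReduces c b
  | swap {m : ℕ} (b : Fin m → Vec d) (i j : Fin m) :
      (j : ℕ) = (i : ℕ) + 1 → ¬ Lovasz b i j →
      LLLReduces c (fun k => b (Equiv.swap i j k)) → LLLReduces c b
  | drop {m : ℕ} (b : Fin (m + 1) → Vec d) (i : Fin (m + 1)) :
      b i = 0 → LLLReduces c (fun k => b (i.succAbove k)) → LLLReduces c b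

/-! ### The quantum enumeration -/

/-- The bound `mᵢ = A · ‖b̂ᵢ‖` on the coefficient `|xᵢ|`, for the radius `A = C · gh(L)`. -/
def coeffBound (C : ℝ) {n : ℕ} (b : Fin n → Vec d) (i : Fin n) : ℝ :=
  C * gh b * ‖dualBasis b i‖

/-- The number of qubits `∑ᵢ (⌊log₂ (2 mᵢ)⌋ + 1)` of the enumeration on the basis `b`. -/
def numQubits (C : ℝ) {n : ℕ} (b : Fin n → Vec d) : ℤ :=
  ∑ i, (⌊Real.logb 2 (2 * coeffBound C b i)⌋ + 1)

/-- The integer bounds `aᵢ = ⌊mᵢ⌋` used to encode the coefficients. -/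
def intBound (C : ℝ) {n : ℕ} (b : Fin n → Vec d) (i : Fin n) : ℕ :=
  ⌊coeffBound C b i⌋₊

/-- The number of binary variables that encode an integer of absolute value at most `a`:
`⌊log₂ (2a)⌋ + 1`, and none if `a = 0`, where the integer is the constant `0`. -/
def numBits (a : ℕ) : ℕ :=
  if a = 0 then 0 else Nat.log 2 (2 * a) + 1

/-- The weight of the `j`-th binary variable: `2^j` for `j < ⌊log₂ (2a)⌋`, and
`2a + 1 - 2^⌊log₂ (2a)⌋` for the last one. -/
def bitWeight (a j : ℕ) : ℤ :=
  if j < Nat.log 2 (2 * a) then 2 ^ j else 2 * (a : ℤ) + 1 - 2 ^ Nat.log 2 (2 * a)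

/-- The qubits of the register: `numBits (a i)` of them for the `i`-th coefficient. -/
abbrev Qubit {n : ℕ} (a : Fin n → ℕ) : Type := (i : Fin n) × Fin (numBits (a i))

/-- The integer coefficients `x₁, …, xₙ` encoded by a bit string. -/
def decode {n : ℕ} (a : Fin n → ℕ) (s : Qubit a → Bool) (i : Fin n) : ℤ :=
  -(a i : ℤ) + ∑ j : Fin (numBits (a i)), if s ⟨i, j⟩ then bitWeight (a i) j else 0

/-- The Pauli operator `Z` on the qubit `q`, in the computational basis of the register. -/
def pauliZ {n : ℕ} (a : Fin n → ℕ) (q : Qubit a) :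
    Matrix (Qubit a → Bool) (Qubit a → Bool) ℂ :=
  Matrix.diagonal fun s => if s q then -1 else 1

/-- The operator of the `i`-th coefficient: each binary variable is replaced by `(I - Z) / 2`. -/
def coeffOp {n : ℕ} (a : Fin n → ℕ) (i : Fin n) :
    Matrix (Qubit a → Bool) (Qubit a → Bool) ℂ :=
  (-(a i : ℂ)) • (1 : Matrix (Qubit a → Bool) (Qubit a → Bool) ℂ) +
    ∑ j : Fin (numBits (a i)), (bitWeight (a i) j : ℂ) • ((1 / 2 : ℂ) • (1 - pauliZ a ⟨i, j⟩))

/-- The Hamiltonian of the quadratic form `x G xᵀ`, where `G` is the Gram matrix of `b`. -/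
def hamiltonian {n : ℕ} (b : Fin n → Vec d) (a : Fin n → ℕ) :
    Matrix (Qubit a → Bool) (Qubit a → Bool) ℂ :=
  ∑ i, ∑ k, ((gram b i k : ℝ) : ℂ) • (coeffOp a i * coeffOp a k)

/-- The energy `⟨s| H |s⟩` of a computational basis state. -/
def energy {n : ℕ} (b : Fin n → Vec d) (a : Fin n → ℕ) (s : Qubit a → Bool) : ℝ :=
  (hamiltonian b a s s).re

/-- `v` is a result of the (exact) enumeration on `b` with radius `C · gh(L)`: the lattice vector of
a bit string of lowest nonzero energy.  If all energies are zero, that is if the search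
space is `{0}`, the result is `0`. -/
def EnumOutput (C : ℝ) {n : ℕ} (b : Fin n → Vec d) (v : Vec d) : Prop :=
  (∃ s : Qubit (intBound C b) → Bool,
      energy b (intBound C b) s ≠ 0 ∧
      (∀ t, energy b (intBound C b) t ≠ 0 →
        energy b (intBound C b) s ≤ energy b (intBound C b) t) ∧
      v = ∑ i, decode (intBound C b) s i • b i) ∨
  ((∀ t, energy b (intBound C b) t = 0) ∧ v = 0)

/-- The size of the quantum register of the enumeration on `b`. -/
def registerSize (C : ℝ) {n : ℕ} (b : Fin n → Vec d) : ℕ :=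
  Fintype.card (Qubit (intBound C b))

/-! ### The recursive HKZ reduction -/

/-- `HKZRun C b out calls`: the recursive algorithm, started on the basis `b`, can return `out`, and
`calls` is the list of the bases on which it runs the quantum enumeration.

One level in rank `≥ 2`: the dual basis of `b` is LLL-reduced to `d₁`; all vectors of `d₁` but the
last one are HKZ-reduced recursively to `e`; the enumeration runs on the dual basis of
`(e, last vector of d₁)` and gives `v`; the system `v` followed by that dual basis is
LLL-reduced to `b₂`; the projections of the other vectors of `b₂` orthogonally to the first one are
HKZ-reduced recursively to `f`; these are lifted to the lattice. -/
inductive HKZRun (C : ℝ) : {n : ℕ} → (Fin n → Vec d) → (Fin n → Vec d) →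
    List ((k : ℕ) × (Fin k → Vec d)) → Prop
  | base (b : Fin 1 → Vec d) : HKZRun C b b []
  | step {n : ℕ} (b d₁ b₁ b₂ out : Fin (n + 2) → Vec d) (e f : Fin (n + 1) → Vec d)
      (v : Vec d) (α : Fin (n + 1) → ℝ) (calls₁ calls₂ : List ((k : ℕ) × (Fin k → Vec d))) :
      LLLReduces d₁ (dualBasis b) →
      HKZRun C (fun i => d₁ (Fin.castSucc i)) e calls₁ →
      b₁ = dualBasis (Fin.snoc (α := fun _ => Vec d) e (d₁ (Fin.last (n + 1)))) →
      EnumOutput C b₁ v →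
      LLLReduces b₂ (Fin.cons (α := fun _ => Vec d) v b₁) →
      HKZRun C (fun i => projPerp (b₂ 0) (b₂ (Fin.succ i))) f calls₂ →
      out 0 = b₂ 0 →
      (∀ i, α i ∈ Set.Ioc (-(1 / 2) : ℝ) (1 / 2) ∧
        out (Fin.succ i) = f i + α i • b₂ 0 ∧ out (Fin.succ i) ∈ lattice b) →
      HKZRun C b out (calls₁ ++ ⟨n + 2, b₁⟩ :: calls₂)

end QuantumHKZ

end

/-!
The algorithm keeps a basis of the same lattice at each step: an LLL reduction changes a system only by
integral operations, the lattice of a dual basis depends only on the lattice of the basis, and lifts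
of a basis of the projected lattice complete the first vector to a basis.

*Termination.* Only the LLL reductions need an argument, since the recursion lowers the rank. A swap
that repairs Lovász' condition decreases the sequence of the norms of the Gram–Schmidt vectors
lexicographically and keeps their maximum from growing, whereas size-reduction leaves the
Gram–Schmidt vectors alone and bounds the vectors of the system in terms of them. So between two
removals only finitely many size-reduced systems occur (`exists_lllReduces`).

*Correctness.* Under the Gaussian heuristic a shortest vector lies in the search space, because its
coefficients are inner products with the dual basis; the enumeration returns a shortest vector
(`EnumOutput.isShortest`). It stands in front of the system given to LLL, and stays the first nonzero
vector there: only a strictly shorter lattice vector could pass it in a swap, and that is the zero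
vector (`LLLReduces.startsShortest`).

*Number of qubits.* The product of the bounds `mᵢ` is `(C gh)ⁿ` times the product of the norms of the
dual basis, so up to rounding the number of qubits is governed by the orthogonality defect of that
dual basis. All its vectors but the last form an HKZ-reduced basis. For such a basis the argument of
Minkowski's second theorem works with the running maxima of the Gram–Schmidt norms in place of the
successive minima (`IsHKZ.prod_runningMax_le`), and size-reduction bounds `‖bᵢ‖²` by `(i + 3) / 4`
times the square of the `i`-th maximum, `i = 1, …, n`. The last vector comes from an LLL-reduced
basis and costs a factor of at most `2^(n/2)` (`IsLLLReduced.norm_last_sq_le`). With Stirling's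
formula these estimates give the bound, the exponential terms fitting because `π e ≥ 8`. A call in
rank `k ≤ n` is compared with rank `n` in `le_mul_logb_of_le`.
-/

namespace QuantumHKZ

open InnerProductSpace Module

variable {d : ℕ}

/-! ### Gram–Schmidt orthogonalisation -/

theorem inner_gramSchmidt_of_lt {n : ℕ} (b : Fin n → Vec d) {j k : Fin n} (h : j < k) :
    inner ℝ (gramSchmidt ℝ b k) (b j) = 0 :=
  gramSchmidt_inv_triangular ℝ b h

theorem sub_gramSchmidt_mem_span {n : ℕ} (b : Fin n → Vec d) (k : Fin n) :
    b k - gramSchmidt ℝ b k ∈ Submodule.span ℝ (b '' Set.Iio k) := by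
  rw [gramSchmidt_def ℝ b k, sub_sub_cancel, ← span_gramSchmidt_Iio ℝ b k]
  refine Submodule.sum_mem _ fun i hi => ?_
  refine Submodule.span_mono (Set.singleton_subset_iff.2 ?_)
    (Submodule.starProjection_apply_mem _ _)
  exact ⟨i, Finset.mem_Iio.1 hi, rfl⟩

theorem inner_eq_zero_of_mem_span {s : Set (Vec d)} {u y : Vec d}
    (h : ∀ x ∈ s, inner ℝ u x = 0) (hy : y ∈ Submodule.span ℝ s) : inner ℝ u y = 0 := by
  induction hy using Submodule.span_induction with
  | mem x hx => exact h x hx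
  | zero => exact inner_zero_right _
  | add x y _ _ hx hy => rw [inner_add_right, hx, hy, add_zero]
  | smul a x _ hx => rw [inner_smul_right, hx, mul_zero]

theorem inner_gramSchmidt_of_mem_span {n : ℕ} (b : Fin n → Vec d) {k : Fin n} {y : Vec d}
    (hy : y ∈ Submodule.span ℝ (b '' Set.Iio k)) : inner ℝ (gramSchmidt ℝ b k) y = 0 := by
  refine inner_eq_zero_of_mem_span ?_ hy
  rintro _ ⟨j, hj, rfl⟩
  exact inner_gramSchmidt_of_lt b hj

/-- The defining property of the `k`-th Gram–Schmidt vector. -/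
theorem eq_gramSchmidt {n : ℕ} (b : Fin n → Vec d) (k : Fin n) (u : Vec d)
    (h₁ : ∀ j < k, inner ℝ u (b j) = 0) (h₂ : b k - u ∈ Submodule.span ℝ (b '' Set.Iio k)) :
    u = gramSchmidt ℝ b k := by
  have hs : gramSchmidt ℝ b k - u ∈ Submodule.span ℝ (b '' Set.Iio k) := by
    have := Submodule.sub_mem _ h₂ (sub_gramSchmidt_mem_span b k)
    rwa [sub_sub_sub_cancel_left] at this
  have h₃ : inner ℝ u (gramSchmidt ℝ b k - u) = 0 := by
    refine inner_eq_zero_of_mem_span ?_ hs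
    rintro _ ⟨j, hj, rfl⟩
    exact h₁ j hj
  have h₄ := inner_gramSchmidt_of_mem_span b hs
  have : inner ℝ (gramSchmidt ℝ b k - u) (gramSchmidt ℝ b k - u) = 0 := by
    rw [inner_sub_left, h₃, h₄, sub_zero]
  exact (sub_eq_zero.1 (inner_self_eq_zero.1 this)).symm

/-- The Gram–Schmidt vector depends only on the span of the preceding vectors, and on the vector
itself modulo this span. -/
theorem gramSchmidt_congr {m n : ℕ} (b : Fin n → Vec d) (b' : Fin m → Vec d) (k : Fin n)
    (k' : Fin m)
    (h₁ : Submodule.span ℝ (b '' Set.Iio k) = Submodule.span ℝ (b' '' Set.Iio k'))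
    (h₂ : b' k' - b k ∈ Submodule.span ℝ (b '' Set.Iio k)) :
    gramSchmidt ℝ b' k' = gramSchmidt ℝ b k := by
  symm
  apply eq_gramSchmidt
  · intro j hj
    apply inner_gramSchmidt_of_mem_span
    rw [h₁]
    exact Submodule.subset_span ⟨j, hj, rfl⟩
  · rw [← h₁]
    have := Submodule.add_mem _ h₂ (sub_gramSchmidt_mem_span b k)
    rwa [sub_add_sub_cancel] at this

/-- The Gram–Schmidt vector is the shortest vector in its coset. -/
theorem norm_gramSchmidt_le {n : ℕ} (b : Fin n → Vec d) (k : Fin n) (y : Vec d)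
    (hy : y ∈ Submodule.span ℝ (b '' Set.Iio k)) : ‖gramSchmidt ℝ b k‖ ≤ ‖b k - y‖ := by
  have h : b k - y = gramSchmidt ℝ b k + (b k - gramSchmidt ℝ b k - y) := by abel
  have h0 := inner_gramSchmidt_of_mem_span b (Submodule.sub_mem _ (sub_gramSchmidt_mem_span b k) hy)
  have := norm_add_sq_eq_norm_sq_add_norm_sq_real h0
  rw [← h] at this
  nlinarith [norm_nonneg (b k - y), norm_nonneg (gramSchmidt ℝ b k),
    mul_self_nonneg ‖b k - gramSchmidt ℝ b k - y‖]

theorem inner_gramSchmidt_self {n : ℕ} (b : Fin n → Vec d) (k : Fin n) :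
    inner ℝ (b k) (gramSchmidt ℝ b k) = ‖gramSchmidt ℝ b k‖ ^ 2 := by
  have := inner_gramSchmidt_of_mem_span b (sub_gramSchmidt_mem_span b k)
  rw [inner_sub_right, real_inner_self_eq_norm_sq, real_inner_comm] at this
  linarith

theorem mu_of_lt {n : ℕ} (b : Fin n → Vec d) {i j : Fin n} (h : i < j) : mu b i j = 0 := by
  rw [mu, real_inner_comm, inner_gramSchmidt_of_lt b h, zero_div]

theorem mu_self {n : ℕ} (b : Fin n → Vec d) {i : Fin n} (h : gramSchmidt ℝ b i ≠ 0) :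
    mu b i i = 1 := by
  rw [mu, inner_gramSchmidt_self, div_self]
  exact pow_ne_zero _ (norm_ne_zero_iff.2 h)

theorem mu_mul_sq {n : ℕ} (b : Fin n → Vec d) (i j : Fin n) :
    mu b i j * ‖gramSchmidt ℝ b j‖ ^ 2 = inner ℝ (b i) (gramSchmidt ℝ b j) := by
  by_cases h : gramSchmidt ℝ b j = 0
  · simp [h]
  · rw [mu, div_mul_cancel₀]
    exact pow_ne_zero _ (norm_ne_zero_iff.2 h)

theorem eq_gramSchmidt_add_sum {n : ℕ} (b : Fin n → Vec d) (i : Fin n) :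
    b i = gramSchmidt ℝ b i + ∑ j ∈ Finset.Iio i, mu b i j • gramSchmidt ℝ b j := by
  conv_lhs => rw [gramSchmidt_def'' ℝ b i]
  simp [mu, real_inner_comm]

theorem norm_sum_smul_gramSchmidt_sq {n : ℕ} (b : Fin n → Vec d) (s : Finset (Fin n))
    (c : Fin n → ℝ) :
    ‖∑ j ∈ s, c j • gramSchmidt ℝ b j‖ ^ 2 = ∑ j ∈ s, c j ^ 2 * ‖gramSchmidt ℝ b j‖ ^ 2 := by
  rw [← real_inner_self_eq_norm_sq, sum_inner]
  refine Finset.sum_congr rfl fun i hi => ?_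
  rw [inner_sum, Finset.sum_eq_single i]
  · rw [inner_smul_left, inner_smul_right, real_inner_self_eq_norm_sq]
    simp; ring
  · intro j _ hj
    rw [inner_smul_left, inner_smul_right, gramSchmidt_orthogonal ℝ b hj.symm]
    simp
  · exact fun h => absurd hi h

theorem norm_sq_eq {n : ℕ} (b : Fin n → Vec d) (i : Fin n) :
    ‖b i‖ ^ 2 = ‖gramSchmidt ℝ b i‖ ^ 2 +
      ∑ j ∈ Finset.Iio i, mu b i j ^ 2 * ‖gramSchmidt ℝ b j‖ ^ 2 := by
  conv_lhs => rw [eq_gramSchmidt_add_sum b i]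
  rw [← norm_sum_smul_gramSchmidt_sq b, sq, sq, sq]
  apply norm_add_sq_eq_norm_sq_add_norm_sq_real
  rw [inner_sum]
  refine Finset.sum_eq_zero fun j hj => ?_
  rw [inner_smul_right, gramSchmidt_orthogonal ℝ b (Finset.mem_Iio.1 hj).ne', mul_zero]

theorem eq_sum_mu {n : ℕ} (b : Fin n → Vec d) (hb : ∀ i, gramSchmidt ℝ b i ≠ 0) (i : Fin n) :
    b i = ∑ j, mu b i j • gramSchmidt ℝ b j := by
  conv_lhs => rw [eq_gramSchmidt_add_sum b i]
  rw [← Finset.sum_subset (Finset.subset_univ (Finset.Iic i)), ← Finset.Iio_insert,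
    Finset.sum_insert (by simp), mu_self b (hb i), one_smul]
  intro j _ hj
  rw [mu_of_lt b (by simpa using hj), zero_smul]

theorem linearIndependent_of_gramSchmidt_ne_zero {n : ℕ} (b : Fin n → Vec d)
    (hb : ∀ i, gramSchmidt ℝ b i ≠ 0) : LinearIndependent ℝ b := by
  have h : LinearIndependent ℝ (gramSchmidt ℝ b) :=
    linearIndependent_of_ne_zero_of_inner_eq_zero hb (gramSchmidt_pairwise_orthogonal ℝ b)
  rw [linearIndependent_iff_card_eq_finrank_span] at h ⊢
  rw [h, Set.finrank, Set.finrank, span_gramSchmidt]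

theorem inner_gram {n : ℕ} (b : Fin n → Vec d) (i j : Fin n) : gram b i j = inner ℝ (b i) (b j) :=
  rfl

/-- The matrix of the Gram–Schmidt coefficients is unitriangular. -/
theorem det_mu {n : ℕ} (b : Fin n → Vec d) (hb : ∀ i, gramSchmidt ℝ b i ≠ 0) :
    (Matrix.of (mu b)).det = 1 := by
  rw [Matrix.det_of_isLowerTriangular]
  · simp [mu_self b (hb _)]
  · intro i j h
    exact mu_of_lt b h

theorem det_gram {n : ℕ} (b : Fin n → Vec d) (hb : LinearIndependent ℝ b) :
    (gram b).det = ∏ i, ‖gramSchmidt ℝ b i‖ ^ 2 := by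
  have h0 := fun i => gramSchmidt_ne_zero (𝕜 := ℝ) i hb
  have h : gram b = Matrix.of (mu b) * Matrix.diagonal (fun i => ‖gramSchmidt ℝ b i‖ ^ 2) *
      (Matrix.of (mu b)).transpose := by
    ext i j
    rw [inner_gram, Matrix.mul_apply]
    simp only [Matrix.mul_diagonal, Matrix.of_apply, Matrix.transpose_apply]
    conv_lhs => rw [eq_sum_mu b h0 i]
    rw [sum_inner]
    refine Finset.sum_congr rfl fun k _ => ?_
    rw [inner_smul_left, real_inner_comm, ← mu_mul_sq]
    simp; ring
  rw [h, Matrix.det_mul, Matrix.det_mul, Matrix.det_transpose, det_mu b h0, Matrix.det_diagonal]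
  ring

theorem det_gram_pos {n : ℕ} {b : Fin n → Vec d} (hb : LinearIndependent ℝ b) :
    0 < (gram b).det := by
  rw [det_gram b hb]
  exact Finset.prod_pos fun i _ => pow_pos (norm_pos_iff.2 (gramSchmidt_ne_zero (𝕜 := ℝ) i hb)) 2

theorem latticeDet_eq {n : ℕ} (b : Fin n → Vec d) (hb : LinearIndependent ℝ b) :
    latticeDet b = ∏ i, ‖gramSchmidt ℝ b i‖ := by
  rw [latticeDet, det_gram b hb, Finset.prod_pow, Real.sqrt_sq]
  positivity

/-! ### Projecting along the first vector -/

theorem inner_projPerp_left (v x : Vec d) : inner ℝ v (projPerp v x) = 0 :=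
  Submodule.mem_orthogonal_singleton_iff_inner_right.1 (Submodule.starProjection_apply_mem _ _)

theorem projPerp_eq (v x : Vec d) : projPerp v x = x - (inner ℝ v x / ‖v‖ ^ 2) • v := by
  rw [projPerp, Submodule.starProjection_orthogonal]
  simp [Submodule.starProjection_singleton]

theorem inner_projPerp_right (v x u : Vec d) (hu : inner ℝ u v = 0) :
    inner ℝ u (projPerp v x) = inner ℝ u x := by
  rw [projPerp_eq, inner_sub_right, inner_smul_right, hu, mul_zero, sub_zero]

theorem projPerp_self (v : Vec d) : projPerp v v = 0 := by
  by_cases h : v = 0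
  · simp [projPerp_eq, h]
  · rw [projPerp_eq, real_inner_self_eq_norm_sq, div_self, one_smul, sub_self]
    exact pow_ne_zero _ (norm_ne_zero_iff.2 h)

theorem projPerp_add (v x y : Vec d) : projPerp v (x + y) = projPerp v x + projPerp v y :=
  map_add _ _ _

theorem projPerp_smul (v x : Vec d) (a : ℝ) : projPerp v (a • x) = a • projPerp v x :=
  map_smul _ _ _

theorem norm_projPerp_le (v x : Vec d) : ‖projPerp v x‖ ≤ ‖x‖ :=
  Submodule.norm_starProjection_apply_le _ _

/-- The family of the projections of the vectors after the first one. -/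
noncomputable abbrev projTail {n : ℕ} (b : Fin (n + 1) → Vec d) : Fin n → Vec d :=
  fun i => projPerp (b 0) (b (Fin.succ i))

theorem gramSchmidt_fin_zero {n : ℕ} (b : Fin (n + 1) → Vec d) : gramSchmidt ℝ b 0 = b 0 :=
  gramSchmidt_bot ℝ b

theorem gramSchmidt_projTail {n : ℕ} (b : Fin (n + 1) → Vec d) (i : Fin n) :
    gramSchmidt ℝ (projTail b) i = gramSchmidt ℝ b (Fin.succ i) := by
  have h0 : inner ℝ (gramSchmidt ℝ (projTail b) i) (b 0) = 0 := by
    rw [real_inner_comm]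
    have hm := gramSchmidt_mem_span ℝ (projTail b) (le_refl i)
    refine inner_eq_zero_of_mem_span ?_ hm
    rintro _ ⟨j, -, rfl⟩
    exact inner_projPerp_left _ _
  have hz : b 0 ∈ Submodule.span ℝ (b '' Set.Iio (Fin.succ i)) :=
    Submodule.subset_span ⟨0, Fin.succ_pos i, rfl⟩
  have hp : ∀ j, b (Fin.succ j) - projTail b j ∈ Submodule.span ℝ (b '' Set.Iio (Fin.succ i)) := by
    intro j
    rw [projTail, projPerp_eq, sub_sub_cancel]
    exact Submodule.smul_mem _ _ hz
  apply eq_gramSchmidt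
  · intro j hj
    induction j using Fin.cases with
    | zero => exact h0
    | succ j =>
      rw [← inner_projPerp_right _ _ _ h0]
      exact inner_gramSchmidt_of_lt (projTail b) (Fin.succ_lt_succ_iff.1 hj)
  · have h1 : Submodule.span ℝ (projTail b '' Set.Iio i) ≤
        Submodule.span ℝ (b '' Set.Iio (Fin.succ i)) := by
      rw [Submodule.span_le]
      rintro _ ⟨j, hj, rfl⟩
      have hj' : b (Fin.succ j) ∈ Submodule.span ℝ (b '' Set.Iio (Fin.succ i)) :=
        Submodule.subset_span ⟨Fin.succ j, Fin.succ_lt_succ_iff.2 hj, rfl⟩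
      have := Submodule.sub_mem _ hj' (hp j)
      rwa [sub_sub_cancel] at this
    have := Submodule.add_mem _ (hp i) (h1 (sub_gramSchmidt_mem_span (projTail b) i))
    rwa [sub_add_sub_cancel] at this

theorem mu_projTail {n : ℕ} (b : Fin (n + 1) → Vec d) (i j : Fin n) :
    mu (projTail b) i j = mu b (Fin.succ i) (Fin.succ j) := by
  rw [mu, mu, gramSchmidt_projTail, real_inner_comm, projTail, inner_projPerp_right,
    real_inner_comm]
  exact inner_gramSchmidt_of_lt b (Fin.succ_pos j)

theorem linearIndependent_projTail {n : ℕ} {b : Fin (n + 1) → Vec d} (hb : LinearIndependent ℝ b) :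
    LinearIndependent ℝ (projTail b) := by
  apply linearIndependent_of_gramSchmidt_ne_zero
  intro i
  rw [gramSchmidt_projTail]
  exact gramSchmidt_ne_zero (𝕜 := ℝ) _ hb

/-! ### Lattices and dual bases -/

theorem mem_lattice_iff {n : ℕ} {b : Fin n → Vec d} {x : Vec d} :
    x ∈ lattice b ↔ ∃ c : Fin n → ℤ, x = ∑ i, c i • b i := by
  rw [lattice, Submodule.mem_span_range_iff_exists_fun]
  exact exists_congr fun c => eq_comm

theorem basis_mem_lattice {n : ℕ} (b : Fin n → Vec d) (i : Fin n) : b i ∈ lattice b :=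
  Submodule.subset_span ⟨i, rfl⟩

theorem lattice_le_iff {n : ℕ} {b : Fin n → Vec d} {L : Submodule ℤ (Vec d)} :
    lattice b ≤ L ↔ ∀ i, b i ∈ L := by
  rw [lattice, Submodule.span_le, Set.range_subset_iff]
  rfl

theorem lattice_subset_span {n : ℕ} (b : Fin n → Vec d) {x : Vec d} (hx : x ∈ lattice b) :
    x ∈ Submodule.span ℝ (Set.range b) :=
  Submodule.span_subset_span ℤ ℝ _ hx

theorem span_le_of_lattice_le {m n : ℕ} {b : Fin n → Vec d} {c : Fin m → Vec d}
    (h : lattice b ≤ lattice c) :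
    Submodule.span ℝ (Set.range b) ≤ Submodule.span ℝ (Set.range c) := by
  rw [Submodule.span_le]
  rintro _ ⟨i, rfl⟩
  exact lattice_subset_span c (h (basis_mem_lattice b i))

theorem span_eq_of_lattice_eq {m n : ℕ} {b : Fin n → Vec d} {c : Fin m → Vec d}
    (h : lattice b = lattice c) :
    Submodule.span ℝ (Set.range b) = Submodule.span ℝ (Set.range c) :=
  le_antisymm (span_le_of_lattice_le h.le) (span_le_of_lattice_le h.ge)

/-- Two bases of the same lattice have the same length. -/
theorem rank_eq_of_lattice_eq {m n : ℕ} {b : Fin n → Vec d} {c : Fin m → Vec d}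
    (hb : LinearIndependent ℝ b) (hc : LinearIndependent ℝ c) (h : lattice b = lattice c) :
    n = m := by
  have h₁ := linearIndependent_iff_card_eq_finrank_span.1 hb
  have h₂ := linearIndependent_iff_card_eq_finrank_span.1 hc
  rw [Set.finrank, Fintype.card_fin] at h₁ h₂
  rw [h₁, h₂, span_eq_of_lattice_eq h]

/-- A generating system with as many vectors as the rank of its lattice is a basis. -/
theorem linearIndependent_of_lattice_eq {n : ℕ} {b c : Fin n → Vec d}
    (hb : LinearIndependent ℝ b) (h : lattice c = lattice b) : LinearIndependent ℝ c := by
  rw [linearIndependent_iff_card_eq_finrank_span] at hb ⊢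
  rw [hb, Set.finrank, Set.finrank, span_eq_of_lattice_eq h]

theorem inner_dualBasis {n : ℕ} {b : Fin n → Vec d} (hb : LinearIndependent ℝ b) (i j : Fin n) :
    inner ℝ (dualBasis b i) (b j) = if i = j then (1 : ℝ) else 0 := by
  have h : ((gram b)⁻¹ * gram b) i j = inner ℝ (dualBasis b i) (b j) := by
    rw [dualBasis, sum_inner, Matrix.mul_apply]
    refine Finset.sum_congr rfl fun k _ => ?_
    rw [inner_smul_left]; rfl
  rw [← h, Matrix.nonsing_inv_mul _ (det_gram_pos hb).ne'.isUnit, Matrix.one_apply]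

theorem dualBasis_mem_span {n : ℕ} (b : Fin n → Vec d) (i : Fin n) :
    dualBasis b i ∈ Submodule.span ℝ (Set.range b) :=
  Submodule.sum_mem _ fun j _ => Submodule.smul_mem _ _ (Submodule.subset_span ⟨j, rfl⟩)

theorem inner_dualBasis_sum {n : ℕ} {b : Fin n → Vec d} (hb : LinearIndependent ℝ b)
    (c : Fin n → ℝ) (i : Fin n) : inner ℝ (dualBasis b i) (∑ j, c j • b j) = c i := by
  rw [inner_sum]
  simp [inner_smul_right, inner_dualBasis hb]

theorem inner_dualBasis_sum_int {n : ℕ} {b : Fin n → Vec d} (hb : LinearIndependent ℝ b)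
    (c : Fin n → ℤ) (i : Fin n) : inner ℝ (dualBasis b i) (∑ j, c j • b j) = c i := by
  simp_rw [← Int.cast_smul_eq_zsmul ℝ]
  exact inner_dualBasis_sum hb (fun j => (c j : ℝ)) i

theorem sum_inner_dualBasis_smul {n : ℕ} {b : Fin n → Vec d} (hb : LinearIndependent ℝ b)
    {x : Vec d} (hx : x ∈ Submodule.span ℝ (Set.range b)) :
    x = ∑ i, (inner ℝ (dualBasis b i) x : ℝ) • b i := by
  obtain ⟨c, rfl⟩ := (Submodule.mem_span_range_iff_exists_fun ℝ).1 hx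
  simp_rw [inner_dualBasis_sum hb]

theorem linearIndependent_dualBasis {n : ℕ} {b : Fin n → Vec d} (hb : LinearIndependent ℝ b) :
    LinearIndependent ℝ (dualBasis b) := by
  rw [Fintype.linearIndependent_iff]
  intro c hc i
  have h : inner ℝ (∑ j, c j • dualBasis b j) (b i) = (0 : ℝ) := by rw [hc, inner_zero_left]
  simpa [sum_inner, inner_smul_left, inner_dualBasis hb] using h

theorem span_dualBasis {n : ℕ} {b : Fin n → Vec d} (hb : LinearIndependent ℝ b) :
    Submodule.span ℝ (Set.range (dualBasis b)) = Submodule.span ℝ (Set.range b) := by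
  apply Submodule.eq_of_le_of_finrank_eq
  · rw [Submodule.span_le]
    rintro _ ⟨i, rfl⟩
    exact dualBasis_mem_span b i
  · exact (linearIndependent_iff_card_eq_finrank_span.1 (linearIndependent_dualBasis hb)).symm.trans
      (linearIndependent_iff_card_eq_finrank_span.1 hb)

theorem eq_of_inner_eq_of_mem_span {n : ℕ} {b : Fin n → Vec d} {x y : Vec d}
    (hx : x ∈ Submodule.span ℝ (Set.range b)) (hy : y ∈ Submodule.span ℝ (Set.range b))
    (h : ∀ j, inner ℝ x (b j) = (inner ℝ y (b j) : ℝ)) : x = y := by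
  have h₀ : inner ℝ (x - y) (x - y) = (0 : ℝ) := by
    refine inner_eq_zero_of_mem_span ?_ (Submodule.sub_mem _ hx hy)
    rintro _ ⟨j, rfl⟩
    rw [inner_sub_left, h j, sub_self]
  exact sub_eq_zero.1 (inner_self_eq_zero.1 h₀)

theorem dualBasis_dualBasis {n : ℕ} {b : Fin n → Vec d} (hb : LinearIndependent ℝ b) :
    dualBasis (dualBasis b) = b := by
  funext i
  have hd := linearIndependent_dualBasis hb
  refine eq_of_inner_eq_of_mem_span (b := dualBasis b) (dualBasis_mem_span _ i) ?_ fun j => ?_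
  · rw [span_dualBasis hb]
    exact Submodule.subset_span ⟨i, rfl⟩
  · rw [inner_dualBasis hd, real_inner_comm, inner_dualBasis hb]
    simp [eq_comm]

/-- The dual lattice, described without reference to a basis. -/
theorem mem_lattice_dualBasis_iff {n : ℕ} {b : Fin n → Vec d} (hb : LinearIndependent ℝ b)
    {x : Vec d} :
    x ∈ lattice (dualBasis b) ↔ x ∈ Submodule.span ℝ (Set.range b) ∧
      ∀ y ∈ lattice b, ∃ k : ℤ, inner ℝ x y = (k : ℝ) := by
  have hd := linearIndependent_dualBasis hb
  constructor
  · intro hx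
    refine ⟨by rw [← span_dualBasis hb]; exact lattice_subset_span _ hx, fun y hy => ?_⟩
    obtain ⟨c, rfl⟩ := mem_lattice_iff.1 hx
    obtain ⟨e, rfl⟩ := mem_lattice_iff.1 hy
    refine ⟨∑ i, c i * e i, ?_⟩
    simp_rw [sum_inner, ← Int.cast_smul_eq_zsmul ℝ (c _), inner_smul_left,
      inner_dualBasis_sum_int hb]
    simp
  · rintro ⟨hx, h⟩
    choose k hk using fun i => h (b i) (basis_mem_lattice b i)
    refine mem_lattice_iff.2 ⟨k, ?_⟩
    rw [← span_dualBasis hb] at hx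
    conv_lhs => rw [sum_inner_dualBasis_smul hd hx]
    refine Finset.sum_congr rfl fun i _ => ?_
    rw [dualBasis_dualBasis hb, real_inner_comm, hk, Int.cast_smul_eq_zsmul]

theorem lattice_dualBasis_congr {n : ℕ} {b c : Fin n → Vec d} (hb : LinearIndependent ℝ b)
    (hc : LinearIndependent ℝ c) (h : lattice b = lattice c) :
    lattice (dualBasis b) = lattice (dualBasis c) := by
  ext x
  rw [mem_lattice_dualBasis_iff hb, mem_lattice_dualBasis_iff hc, span_eq_of_lattice_eq h, h]

theorem gram_dualBasis {n : ℕ} {b : Fin n → Vec d} (hb : LinearIndependent ℝ b) :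
    gram (dualBasis b) = (gram b)⁻¹ := by
  ext i j
  rw [inner_gram, real_inner_comm, dualBasis, sum_inner]
  simp_rw [inner_smul_left, real_inner_comm (dualBasis b i), inner_dualBasis hb]
  have hs : (gram b)⁻¹.transpose = (gram b)⁻¹ := by
    rw [Matrix.transpose_nonsing_inv]
    congr 1
    ext i j
    exact real_inner_comm (b i) (b j)
  simp only [conj_trivial, mul_ite, mul_one, mul_zero, Finset.sum_ite_eq, Finset.mem_univ, if_true]
  rw [← Matrix.transpose_apply ((gram b)⁻¹) i j, hs]

theorem latticeDet_dualBasis {n : ℕ} {b : Fin n → Vec d} (hb : LinearIndependent ℝ b) :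
    latticeDet (dualBasis b) = (latticeDet b)⁻¹ := by
  rw [latticeDet, latticeDet, gram_dualBasis hb, Matrix.det_nonsing_inv, Ring.inverse_eq_inv',
    Real.sqrt_inv]

/-- A lattice has finitely many vectors in each ball. -/
theorem finite_lattice_inter_ball {n : ℕ} {b : Fin n → Vec d} (hb : LinearIndependent ℝ b)
    (R : ℝ) : {x | x ∈ lattice b ∧ ‖x‖ ≤ R}.Finite := by
  let N : Fin n → ℤ := fun i => ⌊‖dualBasis b i‖ * R⌋
  refine ((Set.finite_Icc (-N) N).image fun c => ∑ i, c i • b i).subset ?_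
  rintro x ⟨hx, hR⟩
  obtain ⟨c, rfl⟩ := mem_lattice_iff.1 hx
  refine ⟨c, ?_, rfl⟩
  have h : ∀ i, |(c i : ℝ)| ≤ ‖dualBasis b i‖ * R := fun i => by
    rw [← inner_dualBasis_sum_int hb c i]
    exact (abs_real_inner_le_norm _ _).trans (mul_le_mul_of_nonneg_left hR (norm_nonneg _))
  constructor
  · intro i
    have : -c i ≤ N i := Int.le_floor.2 (by push_cast; exact (neg_le_abs _).trans (h i))
    show -N i ≤ c i
    omega
  · exact fun i => Int.le_floor.2 ((le_abs_self _).trans (h i))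

/-! ### The LLL algorithm -/

theorem lattice_update_sub {m : ℕ} (b : Fin m → Vec d) {i j : Fin m} (h : j ≠ i) (r : ℤ) :
    lattice (Function.update b i (b i - r • b j)) = lattice b := by
  apply le_antisymm
  · rw [lattice_le_iff]
    intro k
    rcases eq_or_ne k i with rfl | hk
    · rw [Function.update_self]
      exact Submodule.sub_mem _ (basis_mem_lattice b k)
        (Submodule.smul_mem _ _ (basis_mem_lattice b j))
    · rw [Function.update_of_ne hk]
      exact basis_mem_lattice b k
  · rw [lattice_le_iff]
    intro k
    have h' : ∀ k ≠ i, b k ∈ lattice (Function.update b i (b i - r • b j)) := fun k hk => by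
      have := basis_mem_lattice (Function.update b i (b i - r • b j)) k
      rwa [Function.update_of_ne hk] at this
    rcases eq_or_ne k i with rfl | hk
    · have := basis_mem_lattice (Function.update b k (b k - r • b j)) k
      rw [Function.update_self] at this
      have h2 := Submodule.add_mem _ this (Submodule.smul_mem _ r (h' j h))
      rwa [sub_add_cancel] at h2
    · exact h' k hk

theorem lattice_comp_equiv {m : ℕ} (b : Fin m → Vec d) (e : Equiv.Perm (Fin m)) :
    lattice (fun k => b (e k)) = lattice b := by
  rw [lattice, lattice]
  congr 1
  exact e.surjective.range_comp b

theorem lattice_succAbove {m : ℕ} (b : Fin (m + 1) → Vec d) {i : Fin (m + 1)} (h : b i = 0) :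
    lattice (fun k => b (i.succAbove k)) = lattice b := by
  apply le_antisymm
  · rw [lattice_le_iff]
    exact fun k => basis_mem_lattice b _
  · rw [lattice_le_iff]
    intro k
    rcases eq_or_ne k i with rfl | hk
    · rw [h]
      exact Submodule.zero_mem _
    · obtain ⟨k', rfl⟩ := Fin.exists_succAbove_eq hk
      exact basis_mem_lattice (fun k => b (i.succAbove k)) k'

theorem LLLReduces.lattice_eq {m n : ℕ} {c : Fin n → Vec d} {b : Fin m → Vec d}
    (h : LLLReduces c b) : lattice c = lattice b := by
  induction h with
  | done _ => rfl
  | sizeReduce b i j hj _ _ ih => rw [ih, lattice_update_sub b hj.ne]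
  | swap b i j _ _ _ ih => rw [ih, lattice_comp_equiv]
  | drop b i h _ ih => rw [ih, lattice_succAbove b h]

theorem LLLReduces.isLLLReduced {m n : ℕ} {c : Fin n → Vec d} {b : Fin m → Vec d}
    (h : LLLReduces c b) : IsLLLReduced c := by
  induction h with
  | done h => exact h
  | sizeReduce _ _ _ _ _ _ ih => exact ih
  | swap _ _ _ _ _ _ ih => exact ih
  | drop _ _ _ _ ih => exact ih

theorem image_update_of_notMem {m : ℕ} (b : Fin m → Vec d) {i : Fin m} {s : Set (Fin m)}
    (h : i ∉ s) (x : Vec d) : Function.update b i x '' s = b '' s :=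
  Set.image_congr fun _ hk => Function.update_of_ne (ne_of_mem_of_not_mem hk h) _ _

theorem span_update_sub {m : ℕ} (b : Fin m → Vec d) {i j k : Fin m} (hj : j < i) (r : ℤ) :
    Submodule.span ℝ (Function.update b i (b i - r • b j) '' Set.Iio k) =
      Submodule.span ℝ (b '' Set.Iio k) := by
  rcases le_or_gt k i with hk | hk
  · rw [image_update_of_notMem b (by simpa using hk)]
  · have hj' : b j ∈ b '' Set.Iio k := ⟨j, hj.trans hk, rfl⟩
    apply le_antisymm
    · rw [Submodule.span_le]
      rintro _ ⟨l, hl, rfl⟩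
      rcases eq_or_ne l i with rfl | hne
      · rw [Function.update_self, ← Int.cast_smul_eq_zsmul ℝ]
        exact Submodule.sub_mem _ (Submodule.subset_span ⟨l, hl, rfl⟩)
          (Submodule.smul_mem _ _ (Submodule.subset_span hj'))
      · rw [Function.update_of_ne hne]
        exact Submodule.subset_span ⟨l, hl, rfl⟩
    · have h' : ∀ l < k, l ≠ i →
          b l ∈ Submodule.span ℝ (Function.update b i (b i - r • b j) '' Set.Iio k) := by
        intro l hl hne
        refine Submodule.subset_span ⟨l, hl, ?_⟩
        rw [Function.update_of_ne hne]
      rw [Submodule.span_le]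
      rintro _ ⟨l, hl, rfl⟩
      rcases eq_or_ne l i with rfl | hne
      · have h1 : b l - r • b j ∈
            Submodule.span ℝ (Function.update b l (b l - r • b j) '' Set.Iio k) := by
          refine Submodule.subset_span ⟨l, hl, ?_⟩
          rw [Function.update_self]
        have h2 := Submodule.add_mem _ h1
          (Submodule.smul_mem _ (r : ℝ) (h' j (hj.trans hk) hj.ne))
        rwa [Int.cast_smul_eq_zsmul, sub_add_cancel] at h2
      · exact h' l hl hne

theorem gramSchmidt_update_sub {m : ℕ} (b : Fin m → Vec d) {i j : Fin m} (hj : j < i) (r : ℤ) :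
    gramSchmidt ℝ (Function.update b i (b i - r • b j)) = gramSchmidt ℝ b := by
  funext k
  apply gramSchmidt_congr _ _ _ _ (span_update_sub b hj r).symm
  rcases eq_or_ne k i with rfl | hk
  · rw [Function.update_self, sub_sub_cancel_left, ← Int.cast_smul_eq_zsmul ℝ, ← neg_smul]
    exact Submodule.smul_mem _ _ (Submodule.subset_span ⟨j, hj, rfl⟩)
  · rw [Function.update_of_ne hk, sub_self]
    exact Submodule.zero_mem _

/-- The relation that size-reduction steps establish between a system `b` and the resulting system `b'`:
both have the same Gram–Schmidt vectors and the same lattice, and each run of the LLL algorithm from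
`b'` extends to one from `b`. -/
def SizeReducesTo {m : ℕ} (b b' : Fin m → Vec d) : Prop :=
  gramSchmidt ℝ b' = gramSchmidt ℝ b ∧ lattice b' = lattice b ∧
    ∀ (n : ℕ) (c : Fin n → Vec d), LLLReduces c b' → LLLReduces c b

theorem SizeReducesTo.refl {m : ℕ} (b : Fin m → Vec d) : SizeReducesTo b b :=
  ⟨rfl, rfl, fun _ _ h => h⟩

theorem SizeReducesTo.trans {m : ℕ} {b b' b'' : Fin m → Vec d} (h : SizeReducesTo b b')
    (h' : SizeReducesTo b' b'') : SizeReducesTo b b'' :=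
  ⟨h'.1.trans h.1, h'.2.1.trans h.2.1, fun n c hc => h.2.2 n c (h'.2.2 n c hc)⟩

theorem mu_update_sub {m : ℕ} (b : Fin m → Vec d) {i j : Fin m} (hj : j < i) (r : ℤ)
    (l : Fin m) :
    mu (Function.update b i (b i - r • b j)) i l = mu b i l - r * mu b j l := by
  rw [mu, gramSchmidt_update_sub b hj, Function.update_self, inner_sub_left,
    ← Int.cast_smul_eq_zsmul ℝ, inner_smul_left, mu, mu, sub_div, mul_div_assoc]
  simp

/-- One vector can be size-reduced, without changing the others: the coefficients are treated from
the last one down, as a reduction with `b j` leaves the coefficients after the `j`-th unchanged. -/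
theorem exists_sizeReducesTo_row {m : ℕ} (b : Fin m → Vec d) (i : Fin m) (t : ℕ) :
    ∃ b', SizeReducesTo b b' ∧ (∀ k ≠ i, b' k = b k) ∧
      ∀ j < i, (i : ℕ) ≤ (j : ℕ) + t → |mu b' i j| ≤ 1 / 2 := by
  induction t with
  | zero => exact ⟨b, .refl b, fun _ _ => rfl, fun j hj h => absurd hj (by omega)⟩
  | succ t ih =>
    obtain ⟨b', hb, hk, hmu⟩ := ih
    by_cases h : ∀ j < i, (i : ℕ) = (j : ℕ) + (t + 1) → |mu b' i j| ≤ 1 / 2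
    · refine ⟨b', hb, hk, fun j hj hle => ?_⟩
      rcases hle.eq_or_lt with he | hlt
      · exact h j hj he
      · exact hmu j hj (by omega)
    · push Not at h
      obtain ⟨j, hj, he, hbig⟩ := h
      refine ⟨Function.update b' i (b' i - round (mu b' i j) • b' j), hb.trans
        ⟨gramSchmidt_update_sub b' hj _, lattice_update_sub b' hj.ne _,
          fun n c hc => .sizeReduce b' i j hj hbig hc⟩, fun k hki => ?_, fun l hl hle => ?_⟩
      · rw [Function.update_of_ne hki, hk k hki]
      · rw [mu_update_sub b' hj]
        rcases hle.eq_or_lt with he' | hlt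
        · obtain rfl : l = j := by ext; omega
          have h0 : gramSchmidt ℝ b' l ≠ 0 := by
            intro h0
            rw [mu, h0] at hbig
            norm_num at hbig
          rw [mu_self b' h0, mul_one]
          exact abs_sub_round _
        · rw [mu_of_lt b' (show j < l by rw [Fin.lt_def]; omega), mul_zero, sub_zero]
          exact hmu l hl (by omega)

theorem exists_sizeReducesTo {m : ℕ} (b : Fin m → Vec d) :
    ∃ b', SizeReducesTo b b' ∧ ∀ i j, j < i → |mu b' i j| ≤ 1 / 2 := by
  suffices h : ∀ s : ℕ, ∃ b', SizeReducesTo b b' ∧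
      ∀ i j : Fin m, (i : ℕ) < s → j < i → |mu b' i j| ≤ 1 / 2 by
    obtain ⟨b', hb, h⟩ := h m
    exact ⟨b', hb, fun i j => h i j i.2⟩
  intro s
  induction s with
  | zero => exact ⟨b, .refl b, fun i j hi => absurd hi (by omega)⟩
  | succ s ih =>
    obtain ⟨b', hb, hmu⟩ := ih
    by_cases hs : s < m
    · obtain ⟨b'', hb', hk, hmu'⟩ := exists_sizeReducesTo_row b' ⟨s, hs⟩ s
      refine ⟨b'', hb.trans hb', fun i j hi hj => ?_⟩
      rcases eq_or_ne i ⟨s, hs⟩ with rfl | hne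
      · exact hmu' j hj (by simp)
      · have : (i : ℕ) ≠ s := fun h => hne (Fin.ext h)
        rw [mu, hk i hne, hb'.1]
        exact hmu i j (by omega) hj
    · exact ⟨b', hb, fun i j hi hj => hmu i j (by omega) hj⟩

/-! ### Swaps in the LLL algorithm -/

theorem gramSchmidt_swap_of_lt {m : ℕ} (b : Fin m → Vec d) {i j k : Fin m}
    (hij : (j : ℕ) = (i : ℕ) + 1) (hk : k < i) :
    gramSchmidt ℝ (fun l => b (Equiv.swap i j l)) k = gramSchmidt ℝ b k := by
  have h : ∀ l ≤ k, b (Equiv.swap i j l) = b l := fun l hl => by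
    rw [Equiv.swap_apply_of_ne_of_ne]
    · exact (hl.trans_lt hk).ne
    · intro h; subst h; rw [Fin.le_def] at hl; rw [Fin.lt_def] at hk; omega
  apply gramSchmidt_congr
  · congr 1
    exact Set.image_congr fun l hl => (h l (le_of_lt hl)).symm
  · rw [h k le_rfl, sub_self]
    exact Submodule.zero_mem _

theorem image_swap_Iio {m : ℕ} (b : Fin m → Vec d) {i j k : Fin m}
    (hk : k ≤ i ∨ j < k) (hij : i < j) :
    (fun l => b (Equiv.swap i j l)) '' Set.Iio k = b '' Set.Iio k := by
  have h : Equiv.swap i j '' Set.Iio k = Set.Iio k := by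
    have : ∀ l ∈ Set.Iio k, Equiv.swap i j l ∈ Set.Iio k := by
      intro l hl
      rcases hk with hk | hk
      · rw [Equiv.swap_apply_of_ne_of_ne]
        · exact hl
        · exact (lt_of_lt_of_le hl hk).ne
        · exact ((lt_of_lt_of_le hl hk).trans hij).ne
      · rcases eq_or_ne l i with rfl | h1
        · rw [Equiv.swap_apply_left]; exact hk
        · rcases eq_or_ne l j with rfl | h2
          · rw [Equiv.swap_apply_right]; exact hij.trans hk
          · rw [Equiv.swap_apply_of_ne_of_ne h1 h2]; exact hl
    apply Set.Subset.antisymm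
    · rintro _ ⟨l, hl, rfl⟩
      exact this l hl
    · intro l hl
      exact ⟨_, this l hl, Equiv.swap_apply_self _ _ _⟩
  conv_rhs => rw [← h, Set.image_image]

theorem gramSchmidt_swap_of_gt {m : ℕ} (b : Fin m → Vec d) {i j k : Fin m}
    (hij : i < j) (hk : j < k) :
    gramSchmidt ℝ (fun l => b (Equiv.swap i j l)) k = gramSchmidt ℝ b k := by
  apply gramSchmidt_congr
  · rw [image_swap_Iio b (.inr hk) hij]
  · rw [Equiv.swap_apply_of_ne_of_ne (hij.trans hk).ne' hk.ne', sub_self]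
    exact Submodule.zero_mem _

theorem Iio_succ_eq {m : ℕ} {i j : Fin m} (hij : (j : ℕ) = (i : ℕ) + 1) :
    Set.Iio j = insert i (Set.Iio i) := by
  ext l
  simp only [Set.mem_Iio, Set.mem_insert_iff, Fin.lt_def, Fin.ext_iff]
  omega

/-- The vector compared in Lovász' condition is the Gram–Schmidt vector after the swap. -/
theorem gramSchmidt_swap_left {m : ℕ} (b : Fin m → Vec d) {i j : Fin m}
    (hij : (j : ℕ) = (i : ℕ) + 1) :
    gramSchmidt ℝ (fun l => b (Equiv.swap i j l)) i =
      gramSchmidt ℝ b j + mu b j i • gramSchmidt ℝ b i := by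
  have hlt : i < j := by rw [Fin.lt_def]; omega
  symm
  apply eq_gramSchmidt
  · intro k hk
    rw [Equiv.swap_apply_of_ne_of_ne hk.ne (hk.trans hlt).ne, inner_add_left, inner_smul_left,
      inner_gramSchmidt_of_lt b hk, inner_gramSchmidt_of_lt b (hk.trans hlt), mul_zero, add_zero]
  · rw [image_swap_Iio b (.inl le_rfl) hlt, Equiv.swap_apply_left]
    rw [eq_gramSchmidt_add_sum b j]
    have hI : Finset.Iio j = insert i (Finset.Iio i) := by
      apply Finset.coe_injective
      simpa using Iio_succ_eq hij
    rw [hI, Finset.sum_insert (by simp), ← add_assoc, add_sub_cancel_left, ← span_gramSchmidt_Iio]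
    exact Submodule.sum_mem _ fun l hl => Submodule.smul_mem _ _
      (Submodule.subset_span ⟨l, Finset.mem_Iio.1 hl, rfl⟩)

theorem norm_gramSchmidt_swap_left_lt {m : ℕ} (b : Fin m → Vec d) {i j : Fin m}
    (hij : (j : ℕ) = (i : ℕ) + 1) (h : ¬ Lovasz b i j) :
    ‖gramSchmidt ℝ (fun l => b (Equiv.swap i j l)) i‖ < ‖gramSchmidt ℝ b i‖ := by
  rw [Lovasz, not_le] at h
  rw [gramSchmidt_swap_left b hij]
  refine lt_of_pow_lt_pow_left₀ 2 (norm_nonneg _) (h.trans_le ?_)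
  nlinarith [sq_nonneg ‖gramSchmidt ℝ b i‖]

theorem norm_gramSchmidt_swap_right_le {m : ℕ} (b : Fin m → Vec d) {i j : Fin m}
    (hij : (j : ℕ) = (i : ℕ) + 1) :
    ‖gramSchmidt ℝ (fun l => b (Equiv.swap i j l)) j‖ ≤ ‖gramSchmidt ℝ b i‖ := by
  have hlt : i < j := by rw [Fin.lt_def]; omega
  have := norm_gramSchmidt_le (fun l => b (Equiv.swap i j l)) j (b i - gramSchmidt ℝ b i) ?_
  · simpa using this
  · have h := sub_gramSchmidt_mem_span b i
    rw [← image_swap_Iio b (.inl le_rfl) hlt] at h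
    exact Submodule.span_mono (Set.image_mono (Set.Iio_subset_Iio hlt.le)) h

theorem norm_gramSchmidt_swap_le {m : ℕ} (b : Fin m → Vec d) {i j : Fin m}
    (hij : (j : ℕ) = (i : ℕ) + 1) (h : ¬ Lovasz b i j) {R : ℝ}
    (hR : ∀ k, ‖gramSchmidt ℝ b k‖ ≤ R) (k : Fin m) :
    ‖gramSchmidt ℝ (fun l => b (Equiv.swap i j l)) k‖ ≤ R := by
  have hlt : i < j := by rw [Fin.lt_def]; omega
  rcases lt_trichotomy k i with hk | rfl | hk
  · rw [gramSchmidt_swap_of_lt b hij hk]; exact hR k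
  · exact (norm_gramSchmidt_swap_left_lt b hij h).le.trans (hR k)
  · rcases eq_or_ne k j with rfl | hne
    · exact (norm_gramSchmidt_swap_right_le b hij).trans (hR i)
    · rw [gramSchmidt_swap_of_gt b hlt]
      · exact hR k
      · rw [Fin.lt_def] at *
        have : (k : ℕ) ≠ j := fun h => hne (Fin.ext h)
        omega

/-! ### Termination of the LLL algorithm -/

/-- The norms of the Gram–Schmidt vectors, with the lexicographic order. -/
noncomputable def profile {m : ℕ} (b : Fin m → Vec d) : Lex (Fin m → ℝ) :=
  toLex fun i => ‖gramSchmidt ℝ b i‖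

theorem profile_swap_lt {m : ℕ} (b : Fin m → Vec d) {i j : Fin m}
    (hij : (j : ℕ) = (i : ℕ) + 1) (h : ¬ Lovasz b i j) :
    profile (fun l => b (Equiv.swap i j l)) < profile b := by
  refine ⟨i, fun k hk => ?_, norm_gramSchmidt_swap_left_lt b hij h⟩
  show ‖gramSchmidt ℝ (fun l => b (Equiv.swap i j l)) k‖ = ‖gramSchmidt ℝ b k‖
  rw [gramSchmidt_swap_of_lt b hij hk]

theorem norm_le_of_sizeReduced {m : ℕ} (b : Fin m → Vec d)
    (hb : ∀ i j, j < i → |mu b i j| ≤ 1 / 2) {R : ℝ} (hR : ∀ k, ‖gramSchmidt ℝ b k‖ ≤ R)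
    (i : Fin m) : ‖b i‖ ≤ R + m * R := by
  have h0 : 0 ≤ R := (norm_nonneg _).trans (hR i)
  rw [eq_gramSchmidt_add_sum b i]
  refine (norm_add_le _ _).trans (add_le_add (hR i) ((norm_sum_le _ _).trans ?_))
  have h : ∀ j ∈ Finset.Iio i, ‖mu b i j • gramSchmidt ℝ b j‖ ≤ R := fun j hj => by
    rw [norm_smul, Real.norm_eq_abs]
    have := mul_le_mul (hb i j (Finset.mem_Iio.1 hj)) (hR j) (norm_nonneg _) (by norm_num)
    linarith
  refine (Finset.sum_le_card_nsmul _ _ _ h).trans ?_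
  rw [nsmul_eq_mul]
  refine mul_le_mul_of_nonneg_right ?_ h0
  exact_mod_cast (Finset.card_le_univ _).trans (Fintype.card_fin m).le

/-- A size-reduced system without zero vectors that satisfies Lovász' condition is independent: a
vanishing Gram–Schmidt vector would violate the condition with its predecessor. -/
theorem gramSchmidt_ne_zero_of_lovasz {m : ℕ} (b : Fin m → Vec d) (h₀ : ∀ i, b i ≠ 0)
    (hb : ∀ i j, j < i → |mu b i j| ≤ 1 / 2)
    (hl : ∀ i j : Fin m, (j : ℕ) = (i : ℕ) + 1 → Lovasz b i j) (k : ℕ) (hk : k < m) :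
    gramSchmidt ℝ b ⟨k, hk⟩ ≠ 0 := by
  induction k with
  | zero =>
    obtain ⟨m, rfl⟩ : ∃ m', m = m' + 1 := ⟨m - 1, by omega⟩
    show gramSchmidt ℝ b 0 ≠ 0
    rw [gramSchmidt_fin_zero]
    exact h₀ 0
  | succ k ih =>
    intro h
    have h1 := hl ⟨k, by omega⟩ ⟨k + 1, hk⟩ rfl
    have h2 := hb ⟨k + 1, hk⟩ ⟨k, by omega⟩ (by simp [Fin.lt_def])
    rw [Lovasz, h, zero_add, norm_smul, mul_pow, Real.norm_eq_abs] at h1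
    have h3 := pow_pos (norm_pos_iff.2 (ih (by omega))) 2
    have h4 : |mu b ⟨k + 1, hk⟩ ⟨k, by omega⟩| ^ 2 ≤ (1 / 2) ^ 2 :=
      pow_le_pow_left₀ (abs_nonneg _) h2 2
    nlinarith

/-- The LLL algorithm can terminate on every generating system of a discrete group.  Swaps decrease
the profile lexicographically, and keep the Gram–Schmidt vectors in a fixed ball, so that only
finitely many size-reduced systems can occur. -/
theorem exists_lllReduces {L : Submodule ℤ (Vec d)}
    (hL : ∀ R : ℝ, {x | x ∈ L ∧ ‖x‖ ≤ R}.Finite) (m : ℕ) (b : Fin m → Vec d)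
    (hb : lattice b = L) : ∃ (n : ℕ) (c : Fin n → Vec d), LLLReduces c b := by
  induction m with
  | zero =>
    refine ⟨0, b, .done ⟨linearIndependent_empty_type, fun i => i.elim0, fun i => i.elim0⟩⟩
  | succ m ihm =>
    obtain ⟨R, hR⟩ : ∃ R : ℝ, ∀ k, ‖gramSchmidt ℝ b k‖ ≤ R :=
      ⟨∑ k, ‖gramSchmidt ℝ b k‖, fun k => Finset.single_le_sum (f := fun k => ‖gramSchmidt ℝ b k‖)
        (fun _ _ => norm_nonneg _) (Finset.mem_univ k)⟩
    let S : Set (Fin (m + 1) → Vec d) :=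
      {b | ∀ i, b i ∈ {x | x ∈ L ∧ ‖x‖ ≤ R + (m + 1 : ℕ) * R}}
    have hS : S.Finite := by
      have : S = Set.pi Set.univ fun _ => {x | x ∈ L ∧ ‖x‖ ≤ R + (m + 1 : ℕ) * R} := by
        ext b; simp [S]
      rw [this]
      exact Set.Finite.pi fun _ => hL _
    have hwf : (profile '' S).WellFoundedOn (· < ·) := (hS.image _).wellFoundedOn
    let P : Lex (Fin (m + 1) → ℝ) → Prop := fun p => ∀ b ∈ S, profile b = p → lattice b = L →
      (∀ k, ‖gramSchmidt ℝ b k‖ ≤ R) → (∀ i j, j < i → |mu b i j| ≤ 1 / 2) →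
      ∃ (n : ℕ) (c : Fin n → Vec d), LLLReduces c b
    have key : ∀ p ∈ profile '' S, P p := by
      intro p hp
      refine hwf.induction (P := P) hp fun p hp ih => ?_
      intro b hbS hbp hbL hbR hmu
      by_cases h0 : ∃ i, b i = 0
      · obtain ⟨i, hi⟩ := h0
        obtain ⟨n, c, hc⟩ := ihm (fun k => b (i.succAbove k)) (by rw [lattice_succAbove b hi, hbL])
        exact ⟨n, c, .drop b i hi hc⟩
      push Not at h0
      by_cases hl : ∀ i j : Fin (m + 1), (j : ℕ) = (i : ℕ) + 1 → Lovasz b i j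
      · have := linearIndependent_of_gramSchmidt_ne_zero b fun i =>
          gramSchmidt_ne_zero_of_lovasz b h0 hmu hl i i.2
        exact ⟨_, b, .done ⟨this, hmu, hl⟩⟩
      push Not at hl
      obtain ⟨i, j, hij, hlov⟩ := hl
      obtain ⟨b', ⟨hgs, hlat, hred⟩, hmu'⟩ :=
        exists_sizeReducesTo (fun l => b (Equiv.swap i j l))
      have hR' : ∀ k, ‖gramSchmidt ℝ b' k‖ ≤ R := by
        rw [hgs]
        exact norm_gramSchmidt_swap_le b hij hlov hbR
      have hL' : lattice b' = L := by rw [hlat, lattice_comp_equiv, hbL]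
      have hS' : b' ∈ S := fun k =>
        ⟨hL' ▸ basis_mem_lattice b' k, norm_le_of_sizeReduced b' hmu' hR' k⟩
      obtain ⟨n, c, hc⟩ := ih (profile b') ⟨b', hS', rfl⟩
        (by rw [← hbp, profile, hgs]; exact profile_swap_lt b hij hlov) b' hS' rfl hL' hR' hmu'
      exact ⟨n, c, .swap b i j hij hlov (hred n c hc)⟩
    obtain ⟨b', ⟨hgs, hlat, hred⟩, hmu⟩ := exists_sizeReducesTo b
    have hR' : ∀ k, ‖gramSchmidt ℝ b' k‖ ≤ R := by rw [hgs]; exact hR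
    have hL' : lattice b' = L := hlat.trans hb
    have hS' : b' ∈ S := fun k =>
      ⟨hL' ▸ basis_mem_lattice b' k, norm_le_of_sizeReduced b' hmu hR' k⟩
    obtain ⟨n, c, hc⟩ := key _ ⟨b', hS', rfl⟩ b' hS' rfl hL' hR' hmu
    exact ⟨n, c, hred n c hc⟩

/-- The form in which termination is used: a system that generates a lattice of rank `n` is reduced
to a basis of `n` vectors. -/
theorem exists_lllReduces_of_lattice_eq {m n : ℕ} {b : Fin n → Vec d} {b' : Fin m → Vec d}
    (hb : LinearIndependent ℝ b) (h : lattice b' = lattice b) :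
    ∃ c : Fin n → Vec d, LLLReduces c b' := by
  obtain ⟨n', c, hc⟩ := exists_lllReduces (finite_lattice_inter_ball hb) m b' h
  obtain rfl := rank_eq_of_lattice_eq hb hc.isLLLReduced.1 (h.symm.trans hc.lattice_eq.symm)
  exact ⟨c, hc⟩

/-! ### A shortest vector in front of an LLL reduction -/

theorem not_lovasz_left_ne_zero {m : ℕ} {b : Fin m → Vec d} {i j : Fin m}
    (h : ¬ Lovasz b i j) : gramSchmidt ℝ b i ≠ 0 := by
  intro h0
  apply h
  rw [Lovasz, h0]
  simp

theorem gramSchmidt_eq_self {m : ℕ} (b : Fin m → Vec d) {i : Fin m} (h : ∀ j < i, b j = 0) :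
    gramSchmidt ℝ b i = b i := by
  symm
  apply eq_gramSchmidt
  · intro j hj
    rw [h j hj, inner_zero_right]
  · rw [sub_self]
    exact Submodule.zero_mem _

/-- The first nonzero vector of the system is a shortest nonzero vector of `L`. -/
def StartsShortest (L : Submodule ℤ (Vec d)) {m : ℕ} (b : Fin m → Vec d) : Prop :=
  ∃ i, IsShortest L (b i) ∧ ∀ j < i, b j = 0

/-- The LLL algorithm never loses a shortest vector in the first place: a swap could replace it only
by a vector whose norm is smaller by a factor, that is by the zero vector. -/
theorem LLLReduces.startsShortest {L : Submodule ℤ (Vec d)} {m n : ℕ} {c : Fin n → Vec d}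
    {b : Fin m → Vec d} (h : LLLReduces c b) (hL : lattice b = L) (hs : StartsShortest L b) :
    StartsShortest L c := by
  induction h with
  | done _ => exact hs
  | sizeReduce b i j hj hmu _ ih =>
    refine ih ((lattice_update_sub b hj.ne _).trans hL) ?_
    obtain ⟨k, hk, h0⟩ := hs
    have hki : k < i := by
      by_contra hik
      have hj0 : b j = 0 := h0 j (hj.trans_le (not_lt.1 hik))
      have : gramSchmidt ℝ b j = 0 := by
        rw [gramSchmidt_eq_self b fun l hl => h0 l (hl.trans (hj.trans_le (not_lt.1 hik))), hj0]
      rw [mu, this] at hmu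
      norm_num at hmu
    refine ⟨k, ?_, fun l hl => ?_⟩
    · rwa [Function.update_of_ne hki.ne]
    · rw [Function.update_of_ne (hl.trans hki).ne, h0 l hl]
  | swap b i j hij hlov _ ih =>
    refine ih ((lattice_comp_equiv b _).trans hL) ?_
    obtain ⟨k, hk, h0⟩ := hs
    have hlt : i < j := by rw [Fin.lt_def]; omega
    have hki : k ≤ i := by
      by_contra hik
      rw [not_le] at hik
      apply not_lovasz_left_ne_zero hlov
      rw [gramSchmidt_eq_self b fun l hl => h0 l (hl.trans hik), h0 i hik]
    rcases hki.eq_or_lt with rfl | hki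
    · refine ⟨j, ?_, fun l hl => ?_⟩
      · simpa using hk
      · rcases eq_or_ne l k with rfl | hne
        · beta_reduce
          rw [Equiv.swap_apply_left]
          -- the vector that passes in front of the shortest one is itself a lattice vector
          by_contra hj0
          have h1 := hk.2.2 (b j) (hL ▸ basis_mem_lattice b j) hj0
          have h2 := norm_gramSchmidt_swap_left_lt b hij hlov
          rw [gramSchmidt_eq_self b h0, gramSchmidt_eq_self, Equiv.swap_apply_left] at h2
          · exact absurd h1 (not_le.2 h2)
          · intro p hp
            rw [Equiv.swap_apply_of_ne_of_ne hp.ne (hp.trans hlt).ne, h0 p hp]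
        · have hlk : l < k := by
            rw [Fin.lt_def] at *
            have : (l : ℕ) ≠ k := fun h => hne (Fin.ext h)
            omega
          beta_reduce
          rw [Equiv.swap_apply_of_ne_of_ne hne hl.ne, h0 l hlk]
    · refine ⟨k, ?_, fun l hl => ?_⟩
      · beta_reduce
        rwa [Equiv.swap_apply_of_ne_of_ne hki.ne (hki.trans hlt).ne]
      · beta_reduce
        rw [Equiv.swap_apply_of_ne_of_ne (hl.trans hki).ne (hl.trans (hki.trans hlt)).ne, h0 l hl]
  | drop b i hi _ ih =>
    refine ih ((lattice_succAbove b hi).trans hL) ?_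
    obtain ⟨k, hk, h0⟩ := hs
    have hne : k ≠ i := by
      rintro rfl
      exact hk.2.1 hi
    obtain ⟨k', rfl⟩ := Fin.exists_succAbove_eq hne
    exact ⟨k', hk, fun l hl => h0 _ ((Fin.strictMono_succAbove i) hl)⟩

theorem LLLReduces.isShortest_zero {L : Submodule ℤ (Vec d)} {m n : ℕ} {c : Fin (n + 1) → Vec d}
    {b : Fin (m + 1) → Vec d} (h : LLLReduces c b) (hL : lattice b = L) (hs : IsShortest L (b 0)) :
    IsShortest L (c 0) := by
  obtain ⟨i, hi, h0⟩ := h.startsShortest hL ⟨0, hs, fun j hj => absurd hj (Fin.not_lt_zero j)⟩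
  rcases eq_or_ne i 0 with rfl | hne
  · exact hi
  · exact absurd (h0 0 (Fin.pos_iff_ne_zero.2 hne)) (h.isLLLReduced.1.ne_zero 0)

/-! ### The enumeration -/

theorem coeffOp_eq {n : ℕ} (a : Fin n → ℕ) (i : Fin n) :
    coeffOp a i = Matrix.diagonal fun s => (decode a s i : ℂ) := by
  ext s t
  rw [coeffOp, Matrix.add_apply, Matrix.sum_apply]
  by_cases h : s = t
  · subst h
    simp only [Matrix.smul_apply, Matrix.one_apply_eq, Matrix.sub_apply, pauliZ,
      Matrix.diagonal_apply_eq, smul_eq_mul, decode]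
    push_cast
    rw [mul_one]
    congr 1
    refine Finset.sum_congr rfl fun j _ => ?_
    split_ifs <;> norm_num
  · simp [pauliZ, h]

theorem energy_eq {n : ℕ} (b : Fin n → Vec d) (a : Fin n → ℕ) (s : Qubit a → Bool) :
    energy b a s = ‖∑ i, decode a s i • b i‖ ^ 2 := by
  have h : hamiltonian b a s s =
      ((∑ i, ∑ k, gram b i k * (decode a s i * decode a s k) : ℝ) : ℂ) := by
    rw [hamiltonian, Matrix.sum_apply]
    push_cast
    refine Finset.sum_congr rfl fun i _ => ?_
    rw [Matrix.sum_apply]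
    refine Finset.sum_congr rfl fun k _ => ?_
    rw [coeffOp_eq, coeffOp_eq, Matrix.diagonal_mul_diagonal, Matrix.smul_apply,
      Matrix.diagonal_apply_eq, smul_eq_mul]
  rw [energy, h, Complex.ofReal_re, ← real_inner_self_eq_norm_sq, sum_inner]
  refine Finset.sum_congr rfl fun i _ => ?_
  rw [inner_sum]
  refine Finset.sum_congr rfl fun k _ => ?_
  rw [← Int.cast_smul_eq_zsmul ℝ, ← Int.cast_smul_eq_zsmul ℝ, inner_smul_left, inner_smul_right,
    inner_gram]
  simp only [conj_trivial]
  ring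

theorem energy_eq_zero_iff {n : ℕ} (b : Fin n → Vec d) (a : Fin n → ℕ) (s : Qubit a → Bool) :
    energy b a s = 0 ↔ ∑ i, decode a s i • b i = 0 := by
  rw [energy_eq, sq_eq_zero_iff, norm_eq_zero]

theorem exists_binary_digits (t y : ℕ) (h : y < 2 ^ t) :
    ∃ f : ℕ → Bool, ∑ j ∈ Finset.range t, (if f j then (2 : ℤ) ^ j else 0) = y := by
  induction t generalizing y with
  | zero =>
    obtain rfl : y = 0 := by simpa using h
    exact ⟨fun _ => false, by simp⟩
  | succ t ih =>
    have key : ∀ (f : ℕ → Bool) (c : Bool), ∑ j ∈ Finset.range (t + 1),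
        (if Function.update f t c j then (2 : ℤ) ^ j else 0) =
        ∑ j ∈ Finset.range t, (if f j then (2 : ℤ) ^ j else 0) + if c then 2 ^ t else 0 := by
      intro f c
      rw [Finset.sum_range_succ, Function.update_self]
      congr 1
      refine Finset.sum_congr rfl fun j hj => ?_
      rw [Function.update_of_ne (Finset.mem_range.1 hj).ne]
    rw [pow_succ] at h
    rcases lt_or_ge y (2 ^ t) with hy | hy
    · obtain ⟨f, hf⟩ := ih y hy
      exact ⟨Function.update f t false, by rw [key, hf]; simp⟩
    · obtain ⟨f, hf⟩ := ih (y - 2 ^ t) (by omega)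
      refine ⟨Function.update f t true, ?_⟩
      rw [key, hf]
      push_cast [hy]
      simp

/-- The weighted bits represent every integer between `0` and `2a`. -/
theorem exists_bits (a y : ℕ) (hy : y ≤ 2 * a) :
    ∃ f : ℕ → Bool,
      ∑ j : Fin (numBits a), (if f j then bitWeight a j else 0) = y := by
  rcases eq_or_ne a 0 with rfl | ha
  · obtain rfl : y = 0 := by omega
    exact ⟨fun _ => false, by simp⟩
  have hn : numBits a = Nat.log 2 (2 * a) + 1 := if_neg ha
  have h1 : 2 ^ Nat.log 2 (2 * a) ≤ 2 * a := Nat.pow_log_le_self 2 (by omega)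
  have h2 : 2 * a < 2 ^ (Nat.log 2 (2 * a) + 1) := Nat.lt_pow_succ_log_self (by norm_num) _
  have hb : bitWeight a (Nat.log 2 (2 * a)) = 2 * (a : ℤ) + 1 - 2 ^ Nat.log 2 (2 * a) := by
    simp [bitWeight]
  have hlow : ∀ j < Nat.log 2 (2 * a), bitWeight a j = 2 ^ j := fun j hj => if_pos hj
  rw [hn]
  generalize Nat.log 2 (2 * a) = t at *
  have key : ∀ (f : ℕ → Bool) (c : Bool), ∑ j : Fin (t + 1),
      (if Function.update f t c j then bitWeight a j else 0) =
      ∑ j ∈ Finset.range t, (if f j then (2 : ℤ) ^ j else 0) + if c then bitWeight a t else 0 := by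
    intro f c
    rw [Fin.sum_univ_eq_sum_range (fun j => if Function.update f t c j then bitWeight a j else 0),
      Finset.sum_range_succ, Function.update_self]
    congr 1
    refine Finset.sum_congr rfl fun j hj => ?_
    rw [Function.update_of_ne (Finset.mem_range.1 hj).ne, hlow j (Finset.mem_range.1 hj)]
  rw [pow_succ] at h2
  rcases lt_or_ge y (2 ^ t) with hlt | hge
  · obtain ⟨f, hf⟩ := exists_binary_digits t y hlt
    exact ⟨Function.update f t false, by rw [key, hf]; simp⟩
  · -- `2a + 1 - 2^t ≤ 2^t ≤ y`, so that the last bit can be set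
    obtain ⟨f, hf⟩ := exists_binary_digits t (y - (2 * a + 1 - 2 ^ t)) (by omega)
    refine ⟨Function.update f t true, ?_⟩
    rw [key, hf, if_pos rfl, hb]
    zify [show 2 * a + 1 - 2 ^ t ≤ y by omega, show 2 ^ t ≤ 2 * a + 1 by omega]
    ring

theorem exists_decode_eq {n : ℕ} (a : Fin n → ℕ) (x : Fin n → ℤ) (hx : ∀ i, |x i| ≤ a i) :
    ∃ s : Qubit a → Bool, ∀ i, decode a s i = x i := by
  have h := fun i => abs_le.1 (hx i)
  choose f hf using fun i => exists_bits (a i) (x i + a i).toNat (by have := h i; omega)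
  refine ⟨fun q => f q.1 q.2, fun i => ?_⟩
  rw [decode, hf i, Int.toNat_of_nonneg (by have := h i; omega)]
  ring

theorem EnumOutput.mem_lattice {C : ℝ} {n : ℕ} {b : Fin n → Vec d} {v : Vec d}
    (h : EnumOutput C b v) : v ∈ lattice b := by
  rcases h with ⟨s, -, -, rfl⟩ | ⟨-, rfl⟩
  · exact mem_lattice_iff.2 ⟨_, rfl⟩
  · exact Submodule.zero_mem _

theorem exists_enumOutput (C : ℝ) {n : ℕ} (b : Fin n → Vec d) : ∃ v, EnumOutput C b v := by
  classical
  by_cases h : ∃ s, energy b (intBound C b) s ≠ 0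
  · obtain ⟨s₀, h₀⟩ := h
    obtain ⟨s, hs, hmin⟩ := Finset.exists_min_image
      (Finset.univ.filter fun s => energy b (intBound C b) s ≠ 0) (energy b (intBound C b))
      ⟨s₀, by simpa using h₀⟩
    exact ⟨_, .inl ⟨s, by simpa using hs, fun t ht => hmin t (by simpa using ht), rfl⟩⟩
  · push Not at h
    exact ⟨0, .inr ⟨h, rfl⟩⟩

/-- The Cauchy–Schwarz bound `|xᵢ| = |⟨b̂ᵢ, w⟩| ≤ ‖b̂ᵢ‖ ‖w‖` puts a shortest vector `w` of norm at most `C · gh`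
into the search space. -/
theorem EnumOutput.isShortest {C : ℝ} {n : ℕ} {b : Fin n → Vec d} {v : Vec d}
    (hb : LinearIndependent ℝ b) (h : EnumOutput C b v) (hG : GaussianHeuristic C b) :
    IsShortest (lattice b) v := by
  obtain ⟨w, hw, hwC⟩ := hG
  obtain ⟨x, hx⟩ := mem_lattice_iff.1 hw.1
  have hbound : ∀ i, |x i| ≤ (intBound C b i : ℤ) := by
    intro i
    have h1 : |(x i : ℝ)| ≤ coeffBound C b i := by
      rw [← inner_dualBasis_sum_int hb x i, ← hx, coeffBound, mul_comm]
      exact (abs_real_inner_le_norm _ _).trans (mul_le_mul_of_nonneg_left hwC (norm_nonneg _))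
    have h2 : (x i).natAbs ≤ intBound C b i := by
      apply Nat.le_floor
      rwa [Nat.cast_natAbs, Int.cast_abs]
    rw [Int.abs_eq_natAbs]
    exact_mod_cast h2
  obtain ⟨s, hs⟩ := exists_decode_eq (intBound C b) x hbound
  have hsw : ∑ i, decode (intBound C b) s i • b i = w := by simp_rw [hs, hx]
  have hs0 : energy b (intBound C b) s ≠ 0 := by
    rw [Ne, energy_eq_zero_iff, hsw]
    exact hw.2.1
  rcases h with ⟨t, ht0, htmin, rfl⟩ | ⟨h0, -⟩
  · refine ⟨mem_lattice_iff.2 ⟨_, rfl⟩, fun h => ht0 ((energy_eq_zero_iff _ _ _).2 h),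
      fun u hu hu0 => le_trans ?_ (hw.2.2 u hu hu0)⟩
    have := htmin s hs0
    rw [energy_eq, energy_eq, hsw] at this
    exact (pow_le_pow_iff_left₀ (norm_nonneg _) (norm_nonneg _) two_ne_zero).1 this
  · exact absurd (h0 s) hs0

theorem numBits_le {a : ℕ} {m : ℝ} (hm : 1 / 4 ≤ m) (ha : a = ⌊m⌋₊) :
    (numBits a : ℤ) ≤ ⌊Real.logb 2 (2 * m)⌋ + 1 := by
  rw [numBits]
  split_ifs with h
  · -- `2m ≥ 1/2`, so that the logarithm is at least `-1`
    have : (-1 : ℤ) ≤ ⌊Real.logb 2 (2 * m)⌋ := by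
      rw [Int.le_floor, Real.le_logb_iff_rpow_le (by norm_num) (by linarith)]
      norm_num
      linarith
    push_cast
    omega
  · have : (Nat.log 2 (2 * a) : ℤ) ≤ ⌊Real.logb 2 (2 * m)⌋ := by
      rw [Int.le_floor, Real.le_logb_iff_rpow_le (by norm_num) (by linarith)]
      have h1 : ((2 ^ Nat.log 2 (2 * a) : ℕ) : ℝ) ≤ ((2 * a : ℕ) : ℝ) :=
        Nat.cast_le.2 (Nat.pow_log_le_self 2 (by omega))
      have h2 : (a : ℝ) ≤ m := by rw [ha]; exact Nat.floor_le (by linarith)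
      push_cast at h1 ⊢
      rw [Real.rpow_natCast]
      linarith
    push_cast
    omega

theorem registerSize_le_numQubits {C : ℝ} {n : ℕ} {b : Fin n → Vec d}
    (h : ∀ i, 1 / 4 ≤ coeffBound C b i) : (registerSize C b : ℝ) ≤ numQubits C b := by
  have h' : (registerSize C b : ℤ) ≤ numQubits C b := by
    rw [registerSize, Fintype.card_sigma, numQubits]
    push_cast
    refine Finset.sum_le_sum fun i _ => ?_
    rw [Fintype.card_fin]
    exact numBits_le (h i) rfl
  exact_mod_cast h'

/-! ### Correctness and termination of the recursive reduction -/

theorem lattice_snoc {n : ℕ} (e : Fin n → Vec d) (x : Vec d) :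
    lattice (Fin.snoc (α := fun _ => Vec d) e x) = lattice e ⊔ Submodule.span ℤ {x} := by
  rw [lattice, lattice, ← Submodule.span_union]
  congr 1
  ext y
  simp only [Set.mem_range, Set.mem_union, Set.mem_singleton_iff]
  constructor
  · rintro ⟨i, rfl⟩
    induction i using Fin.lastCases with
    | last => right; simp
    | cast i => left; exact ⟨i, by simp⟩
  · rintro (⟨i, rfl⟩ | rfl)
    · exact ⟨Fin.castSucc i, by simp⟩
    · exact ⟨Fin.last n, by simp⟩

theorem lattice_cons_of_mem {n : ℕ} {b : Fin n → Vec d} {v : Vec d} (hv : v ∈ lattice b) :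
    lattice (Fin.cons (α := fun _ => Vec d) v b) = lattice b := by
  apply le_antisymm
  · rw [lattice_le_iff]
    intro i
    induction i using Fin.cases with
    | zero => simpa using hv
    | succ i => simpa using basis_mem_lattice b i
  · rw [lattice_le_iff]
    intro i
    simpa using basis_mem_lattice (Fin.cons (α := fun _ => Vec d) v b) (Fin.succ i)

theorem lattice_snoc_eq {n : ℕ} {c : Fin (n + 1) → Vec d} {e : Fin n → Vec d}
    (he : lattice e = lattice fun i => c (Fin.castSucc i)) :
    lattice (Fin.snoc (α := fun _ => Vec d) e (c (Fin.last n))) = lattice c := by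
  have h : c = Fin.snoc (α := fun _ => Vec d) (fun i => c (Fin.castSucc i)) (c (Fin.last n)) :=
    (Fin.snoc_init_self c).symm
  conv_rhs => rw [h]
  rw [lattice_snoc, lattice_snoc, he]

theorem linearIndependent_snoc {n : ℕ} {c : Fin (n + 1) → Vec d} {e : Fin n → Vec d}
    (hc : LinearIndependent ℝ c) (he : lattice e = lattice fun i => c (Fin.castSucc i)) :
    LinearIndependent ℝ (Fin.snoc (α := fun _ => Vec d) e (c (Fin.last n))) :=
  linearIndependent_of_lattice_eq hc (lattice_snoc_eq he)

/-- If the last vector of a basis of the dual lattice is kept and the others are replaced by another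
basis of what they generate, the dual basis of the result is a basis of the lattice. -/
theorem lattice_dualBasis_snoc {n : ℕ} {b c : Fin (n + 1) → Vec d} {e : Fin n → Vec d}
    (hb : LinearIndependent ℝ b) (hc : LinearIndependent ℝ c)
    (hcb : lattice c = lattice (dualBasis b))
    (he : lattice e = lattice fun i => c (Fin.castSucc i)) :
    lattice (dualBasis (Fin.snoc (α := fun _ => Vec d) e (c (Fin.last n)))) = lattice b := by
  rw [lattice_dualBasis_congr (linearIndependent_snoc hc he) (linearIndependent_dualBasis hb)
    ((lattice_snoc_eq he).trans hcb), dualBasis_dualBasis hb]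

theorem projPerp_sum_zsmul {n : ℕ} (v : Vec d) (c : Fin n → ℤ) (b : Fin n → Vec d) :
    projPerp v (∑ i, c i • b i) = ∑ i, c i • projPerp v (b i) :=
  (map_sum _ _ _).trans (Finset.sum_congr rfl fun _ _ => map_zsmul _ _ _)

theorem projPerp_lattice_sum {n : ℕ} (b : Fin (n + 1) → Vec d) (c : Fin (n + 1) → ℤ) :
    projPerp (b 0) (∑ i, c i • b i) = ∑ i : Fin n, c (Fin.succ i) • projTail b i := by
  rw [projPerp_sum_zsmul, Fin.sum_univ_succ, projPerp_self, smul_zero, zero_add]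

theorem projPerp_mem_lattice_projTail {n : ℕ} {b : Fin (n + 1) → Vec d} {w : Vec d}
    (hw : w ∈ lattice b) : projPerp (b 0) w ∈ lattice (projTail b) := by
  obtain ⟨c, rfl⟩ := mem_lattice_iff.1 hw
  exact mem_lattice_iff.2 ⟨_, projPerp_lattice_sum b c⟩

theorem exists_projPerp_eq {n : ℕ} {b : Fin (n + 1) → Vec d} {y : Vec d}
    (hy : y ∈ lattice (projTail b)) : ∃ w ∈ lattice b, projPerp (b 0) w = y := by
  obtain ⟨c, rfl⟩ := mem_lattice_iff.1 hy
  refine ⟨∑ i, (Fin.cons 0 c : Fin (n + 1) → ℤ) i • b i, mem_lattice_iff.2 ⟨_, rfl⟩, ?_⟩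
  rw [projPerp_lattice_sum]
  simp

theorem exists_eq_zsmul_of_projPerp_eq_zero {n : ℕ} {b : Fin (n + 1) → Vec d}
    (hb : LinearIndependent ℝ b) {w : Vec d} (hw : w ∈ lattice b) (h : projPerp (b 0) w = 0) :
    ∃ k : ℤ, w = k • b 0 := by
  obtain ⟨c, rfl⟩ := mem_lattice_iff.1 hw
  rw [projPerp_lattice_sum] at h
  have h0 : ∀ i, c (Fin.succ i) = 0 := fun i => by
    have := inner_dualBasis_sum_int (linearIndependent_projTail hb) (fun i => c (Fin.succ i)) i
    rw [h, inner_zero_right] at this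
    exact_mod_cast this.symm
  refine ⟨c 0, ?_⟩
  rw [Fin.sum_univ_succ]
  simp [h0]

theorem inner_eq_zero_of_mem_lattice_projTail {n : ℕ} {b : Fin (n + 1) → Vec d} {y : Vec d}
    (hy : y ∈ lattice (projTail b)) : inner ℝ (b 0) y = 0 := by
  obtain ⟨w, -, rfl⟩ := exists_projPerp_eq hy
  exact inner_projPerp_left _ _

theorem projPerp_eq_self {v y : Vec d} (h : inner ℝ v y = 0) : projPerp v y = y := by
  rw [projPerp_eq, h, zero_div, zero_smul, sub_zero]

section Lift

variable {n : ℕ} {b out : Fin (n + 1) → Vec d} {f : Fin n → Vec d} {α : Fin n → ℝ}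

theorem projTail_lift (hf : lattice f = lattice (projTail b)) (h₀ : out 0 = b 0)
    (h : ∀ i, out (Fin.succ i) = f i + α i • b 0) : projTail out = f := by
  funext i
  have hi : f i ∈ lattice (projTail b) := hf ▸ basis_mem_lattice f i
  rw [projTail, h₀, h, projPerp_add, projPerp_smul, projPerp_self, smul_zero, add_zero,
    projPerp_eq_self (inner_eq_zero_of_mem_lattice_projTail hi)]

/-- A first basis vector together with lifts of a basis of the projected lattice is a basis. -/
theorem lattice_lift (hb : LinearIndependent ℝ b) (hf : lattice f = lattice (projTail b))
    (h₀ : out 0 = b 0) (h : ∀ i, out (Fin.succ i) = f i + α i • b 0)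
    (hmem : ∀ i, out (Fin.succ i) ∈ lattice b) : lattice out = lattice b := by
  have hle : lattice out ≤ lattice b := by
    rw [lattice_le_iff]
    intro i
    induction i using Fin.cases with
    | zero => rw [h₀]; exact basis_mem_lattice b 0
    | succ i => exact hmem i
  refine le_antisymm hle fun w hw => ?_
  have hp : projPerp (b 0) w ∈ lattice (projTail out) := by
    rw [projTail_lift hf h₀ h, hf]
    exact projPerp_mem_lattice_projTail hw
  obtain ⟨w', hw', hww⟩ := exists_projPerp_eq hp
  rw [h₀] at hww
  have hz : projPerp (b 0) (w - w') = 0 := by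
    have h1 : projPerp (b 0) (w - w') = projPerp (b 0) w - projPerp (b 0) w' := map_sub _ _ _
    rw [h1, hww, sub_self]
  obtain ⟨k, hk⟩ := exists_eq_zsmul_of_projPerp_eq_zero hb (Submodule.sub_mem _ hw (hle hw')) hz
  rw [← sub_add_cancel w w', hk, ← h₀]
  exact Submodule.add_mem _ (Submodule.smul_mem _ _ (basis_mem_lattice out 0)) hw'

theorem exists_lift (hf : lattice f = lattice (projTail b)) (i : Fin n) :
    ∃ a : ℝ, a ∈ Set.Ioc (-(1 / 2) : ℝ) (1 / 2) ∧ f i + a • b 0 ∈ lattice b := by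
  have hi : f i ∈ lattice (projTail b) := hf ▸ basis_mem_lattice f i
  obtain ⟨w, hw, hwf⟩ := exists_projPerp_eq hi
  rw [projPerp_eq] at hwf
  set t : ℝ := inner ℝ (b 0) w / ‖b 0‖ ^ 2
  refine ⟨t - ⌈t - 1 / 2⌉, ⟨?_, ?_⟩, ?_⟩
  · linarith [Int.ceil_lt_add_one (t - 1 / 2)]
  · linarith [Int.le_ceil (t - 1 / 2)]
  · rw [← hwf, sub_smul, Int.cast_smul_eq_zsmul, sub_add_sub_cancel]
    exact Submodule.sub_mem _ hw (Submodule.smul_mem _ _ (basis_mem_lattice b 0))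

end Lift

theorem isHKZ_of_fin_one (b : Fin 1 → Vec d) : IsHKZ b := trivial

/-- A run returns a basis of the lattice, whatever its enumerations find. -/
theorem HKZRun.isBasis {C : ℝ} {n : ℕ} {b out : Fin n → Vec d}
    {calls : List ((k : ℕ) × (Fin k → Vec d))} (h : HKZRun C b out calls)
    (hb : LinearIndependent ℝ b) : LinearIndependent ℝ out ∧ lattice out = lattice b := by
  induction h with
  | base b => exact ⟨hb, rfl⟩
  | step b d₁ b₁ b₂ out e f v α calls₁ calls₂ hd _ hb₁ hv hb₂ _ h₀ hα ih₁ ih₂ =>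
    have hd₁ := hd.isLLLReduced.1
    obtain ⟨-, he⟩ := ih₁ (hd₁.comp _ (Fin.castSucc_injective _))
    have hL₁ : lattice b₁ = lattice b := by
      rw [hb₁]
      exact lattice_dualBasis_snoc hb hd₁ hd.lattice_eq he
    have hL₂ : lattice b₂ = lattice b := by
      rw [hb₂.lattice_eq, lattice_cons_of_mem hv.mem_lattice, hL₁]
    have hb₂' := hb₂.isLLLReduced.1
    obtain ⟨-, hf⟩ := ih₂ (linearIndependent_projTail hb₂')
    have hout : lattice out = lattice b := by
      rw [← hL₂]
      exact lattice_lift hb₂' hf h₀ (fun i => (hα i).2.1) fun i => hL₂ ▸ (hα i).2.2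
    exact ⟨linearIndependent_of_lattice_eq hb hout, hout⟩

theorem HKZRun.isHKZ {C : ℝ} {n : ℕ} {b out : Fin n → Vec d}
    {calls : List ((k : ℕ) × (Fin k → Vec d))} (h : HKZRun C b out calls)
    (hb : LinearIndependent ℝ b) (hG : ∀ c ∈ calls, GaussianHeuristic C c.2) : IsHKZ out := by
  induction h with
  | base b => exact isHKZ_of_fin_one b
  | step b d₁ b₁ b₂ out e f v α calls₁ calls₂ hd hrun₁ hb₁ hv hb₂ hrun₂ h₀ hα ih₁ ih₂ =>
    have hout := (HKZRun.step b d₁ b₁ b₂ out e f v α calls₁ calls₂ hd hrun₁ hb₁ hv hb₂ hrun₂ h₀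
      hα).isBasis hb
    have hd₁ := hd.isLLLReduced.1
    obtain ⟨-, he⟩ := hrun₁.isBasis (hd₁.comp _ (Fin.castSucc_injective _))
    have hL₁ : lattice b₁ = lattice b := by
      rw [hb₁]
      exact lattice_dualBasis_snoc hb hd₁ hd.lattice_eq he
    have hb₁' := linearIndependent_of_lattice_eq hb hL₁
    have hb₂' := hb₂.isLLLReduced.1
    obtain ⟨-, hf⟩ := hrun₂.isBasis (linearIndependent_projTail hb₂')
    have hvs : IsShortest (lattice b₁) v := hv.isShortest hb₁' (hG ⟨_, b₁⟩ (by simp))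
    have hs : IsShortest (lattice b₁) (b₂ 0) :=
      hb₂.isShortest_zero (lattice_cons_of_mem hv.mem_lattice) (by simpa using hvs)
    refine ⟨?_, ?_, fun i => ?_⟩
    · rwa [hout.2, h₀, ← hL₁]
    · have hp : (fun i => projPerp (out 0) (out (Fin.succ i))) = f :=
        projTail_lift hf h₀ fun i => (hα i).2.1
      rw [hp]
      exact ih₂ (linearIndependent_projTail hb₂') fun c hc => hG c (by simp [hc])
    · have hi : f i ∈ lattice (projTail b₂) := hf ▸ basis_mem_lattice f i
      rw [h₀, (hα i).2.1, inner_add_right, inner_eq_zero_of_mem_lattice_projTail hi, zero_add,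
        inner_smul_right, abs_mul]
      refine mul_le_mul_of_nonneg_right (abs_le.2 ⟨?_, (hα i).1.2⟩) (abs_nonneg _)
      exact (hα i).1.1.le

theorem exists_hkzRun (C : ℝ) (n : ℕ) (b : Fin (n + 1) → Vec d) (hb : LinearIndependent ℝ b) :
    ∃ out calls, HKZRun C b out calls := by
  induction n with
  | zero => exact ⟨b, [], .base b⟩
  | succ n ih =>
    obtain ⟨d₁, hd⟩ := exists_lllReduces_of_lattice_eq (linearIndependent_dualBasis hb) rfl
    have hd₁ := hd.isLLLReduced.1
    have hdc := hd₁.comp _ (Fin.castSucc_injective _)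
    obtain ⟨e, calls₁, hrun₁⟩ := ih (fun i => d₁ (Fin.castSucc i)) hdc
    obtain ⟨-, he⟩ := hrun₁.isBasis hdc
    obtain ⟨b₁, hb₁⟩ : ∃ b₁, b₁ =
      dualBasis (Fin.snoc (α := fun _ => Vec d) e (d₁ (Fin.last (n + 1)))) := ⟨_, rfl⟩
    have hL₁ : lattice b₁ = lattice b := by
      rw [hb₁]
      exact lattice_dualBasis_snoc hb hd₁ hd.lattice_eq he
    obtain ⟨v, hv⟩ := exists_enumOutput C b₁
    have hL : lattice (Fin.cons (α := fun _ => Vec d) v b₁) = lattice b :=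
      (lattice_cons_of_mem hv.mem_lattice).trans hL₁
    obtain ⟨b₂, hb₂⟩ := exists_lllReduces_of_lattice_eq hb hL
    have hL₂ : lattice b₂ = lattice b := hb₂.lattice_eq.trans hL
    have ht := linearIndependent_projTail hb₂.isLLLReduced.1
    obtain ⟨f, calls₂, hrun₂⟩ := ih (projTail b₂) ht
    obtain ⟨-, hf⟩ := hrun₂.isBasis ht
    choose α hα using exists_lift hf
    refine ⟨Fin.cons (α := fun _ => Vec d) (b₂ 0) fun i => f i + α i • b₂ 0, _,
      .step b d₁ b₁ b₂ _ e f v α calls₁ calls₂ hd hrun₁ hb₁ hv hb₂ hrun₂ (by simp) fun i =>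
        ⟨(hα i).1, by simp, ?_⟩⟩
    rw [Fin.cons_succ, ← hL₂]
    exact (hα i).2

/-! ### Minkowski's theorem for ellipsoids -/

open MeasureTheory in
/-- Minkowski's theorem for the ellipsoid `‖A x‖ < 1` and the lattice `ℤ^m`; the left hand side is the
volume of the unit ball. -/
theorem ball_volume_le_of_one_le {m : ℕ} (hm : 0 < m) (A : Matrix (Fin m) (Fin m) ℝ)
    (hA : A.det ≠ 0)
    (h : ∀ x : Fin m → ℤ, x ≠ 0 → 1 ≤ ∑ i, (A.mulVec fun j => (x j : ℝ)) i ^ 2) :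
    Real.sqrt Real.pi ^ m / Real.Gamma (m / 2 + 1) ≤ 2 ^ m * |A.det| := by
  have : Nonempty (Fin m) := ⟨⟨0, hm⟩⟩
  set V := Real.sqrt Real.pi ^ m / Real.Gamma (m / 2 + 1) with hV
  have hV0 : 0 < V := div_pos (pow_pos (Real.sqrt_pos.2 Real.pi_pos) _)
    (Real.Gamma_pos_of_pos (by positivity))
  by_contra hlt
  rw [not_le] at hlt
  let t : Set (Fin m → ℝ) := WithLp.toLp 2 ⁻¹' Metric.ball (0 : EuclideanSpace ℝ (Fin m)) 1
  have ht : volume t = ENNReal.ofReal V := by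
    rw [(PiLp.volume_preserving_toLp (Fin m)).measure_preimage
      measurableSet_ball.nullMeasurableSet, EuclideanSpace.volume_ball]
    simp [hV]
  let s : Set (Fin m → ℝ) := Matrix.toLin' A ⁻¹' t
  have hdet : LinearMap.det (Matrix.toLin' A) ≠ 0 := by rwa [LinearMap.det_toLin']
  have hs : volume s = ENNReal.ofReal |A.det⁻¹| * ENNReal.ofReal V := by
    rw [Measure.addHaar_preimage_linearMap _ hdet, LinearMap.det_toLin', ht]
  have hmem : ∀ y, y ∈ s ↔ ∑ i, (A.mulVec y) i ^ 2 < 1 := by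
    intro y
    simp only [s, t, Set.mem_preimage, mem_ball_zero_iff, Matrix.toLin'_apply,
      EuclideanSpace.norm_eq, Real.norm_eq_abs, sq_abs]
    rw [Real.sqrt_lt' one_pos, one_pow]
  have hconv : Convex ℝ s := by
    have h1 : Convex ℝ t := by
      have := (convex_ball (0 : EuclideanSpace ℝ (Fin m)) 1).linear_preimage
        (WithLp.linearEquiv 2 ℝ (Fin m → ℝ)).symm.toLinearMap
      exact this
    exact h1.linear_preimage _
  have hsymm : ∀ y ∈ s, -y ∈ s := by
    intro y hy
    rw [hmem] at hy ⊢
    simpa [Matrix.mulVec_neg] using hy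
  have hfund := ZSpan.isAddFundamentalDomain' (Pi.basisFun ℝ (Fin m)) volume
  have hF : volume (ZSpan.fundamentalDomain (Pi.basisFun ℝ (Fin m))) = 1 := by
    rw [ZSpan.fundamentalDomain_pi_basisFun, Real.volume_pi_Ico]
    simp
  have : Countable (Submodule.span ℤ (Set.range (Pi.basisFun ℝ (Fin m)))).toAddSubgroup :=
    inferInstanceAs (Countable (Submodule.span ℤ (Set.range (Pi.basisFun ℝ (Fin m)))))
  obtain ⟨⟨x, hx⟩, hx0, hxs⟩ :=
    exists_ne_zero_mem_lattice_of_measure_mul_two_pow_lt_measure hfund hsymm hconv (by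
      rw [hF, one_mul, hs, ← ENNReal.ofReal_mul (abs_nonneg _), finrank_fin_fun,
        ← ENNReal.ofReal_ofNat, ← ENNReal.ofReal_pow (by norm_num)]
      refine (ENNReal.ofReal_lt_ofReal_iff (by positivity)).2 ?_
      rw [abs_inv, inv_mul_eq_div, lt_div_iff₀ (abs_pos.2 hA)]
      exact hlt)
  obtain ⟨c, hc⟩ := (Submodule.mem_span_range_iff_exists_fun ℤ).1 hx
  have hxc : x = fun j => (c j : ℝ) := by
    rw [← hc]
    ext j
    simp [Pi.single_apply]
  have hc0 : c ≠ 0 := by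
    rintro rfl
    apply hx0
    ext j
    simp [hxc]
  have h1 := h c hc0
  rw [← hxc] at h1
  exact absurd ((hmem x).1 hxs) (not_lt.2 h1)

/-- Legendre's duplication formula with the log-convexity of the Gamma function. -/
theorem Gamma_half_add_one_sq_le (m : ℕ) :
    Real.Gamma (m / 2 + 1) ^ 2 ≤ 2 * (m + 1).factorial / 2 ^ m := by
  set x : ℝ := (m + 1) / 2 with hx
  have hx0 : 0 < x := by positivity
  have hG := Real.Gamma_pos_of_pos hx0
  have hG' : (0 : ℝ) < Real.Gamma (m / 2 + 1) := Real.Gamma_pos_of_pos (by positivity)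
  have hdup : Real.Gamma x * Real.Gamma (m / 2 + 1) = m.factorial * Real.sqrt Real.pi / 2 ^ m := by
    have := Real.Gamma_mul_Gamma_add_half_of_pos hx0
    rw [show x + 1 / 2 = m / 2 + 1 by rw [hx]; ring, show 2 * x = m + 1 by rw [hx]; ring,
      Real.Gamma_nat_eq_factorial, show (1 : ℝ) - (m + 1) = -(m : ℝ) by ring,
      Real.rpow_neg (by norm_num), Real.rpow_natCast] at this
    rw [this]
    ring
  have hconv : Real.Gamma (m / 2 + 1) ≤ (m + 1) * Real.Gamma x := by
    have h := Real.Gamma_mul_add_mul_le_rpow_Gamma_mul_rpow_Gamma hx0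
      (show 0 < x + 1 by linarith) (show (0 : ℝ) < 1 / 2 by norm_num)
      (show (0 : ℝ) < 1 / 2 by norm_num) (by norm_num)
    rw [show 1 / 2 * x + 1 / 2 * (x + 1) = m / 2 + 1 by rw [hx]; ring,
      ← Real.mul_rpow hG.le (Real.Gamma_pos_of_pos (by linarith)).le, Real.Gamma_add_one hx0.ne',
      ← Real.sqrt_eq_rpow] at h
    refine h.trans (Real.sqrt_le_iff.2 ⟨by positivity, ?_⟩)
    have h1 : x ≤ (m + 1) ^ 2 := by rw [hx]; nlinarith [(Nat.cast_nonneg m : (0 : ℝ) ≤ m)]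
    nlinarith [mul_le_mul_of_nonneg_right h1 (sq_nonneg (Real.Gamma x))]
  have hpi : Real.sqrt Real.pi ≤ 2 := by
    rw [Real.sqrt_le_iff]
    exact ⟨by norm_num, by nlinarith [Real.pi_le_four]⟩
  calc Real.Gamma (m / 2 + 1) ^ 2
      ≤ (m + 1) * Real.Gamma x * Real.Gamma (m / 2 + 1) := by
        rw [sq]; exact mul_le_mul_of_nonneg_right hconv hG'.le
    _ = (m + 1) * (m.factorial * Real.sqrt Real.pi / 2 ^ m) := by rw [mul_assoc, hdup]
    _ ≤ (m + 1) * (m.factorial * 2 / 2 ^ m) := by gcongr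
    _ = 2 * (m + 1).factorial / 2 ^ m := by
        rw [Nat.factorial_succ]; push_cast; ring

/-! ### The orthogonality defect of HKZ-reduced bases -/

theorem norm_le_norm_zsmul {x : Vec d} {k : ℤ} (hk : k ≠ 0) : ‖x‖ ≤ ‖k • x‖ := by
  rw [← Int.cast_smul_eq_zsmul ℝ, norm_smul, Real.norm_eq_abs]
  have : (1 : ℝ) ≤ |(k : ℝ)| := by exact_mod_cast Int.one_le_abs hk
  nlinarith [norm_nonneg x]

theorem sum_zsmul_ne_zero {n : ℕ} {b : Fin n → Vec d} (hb : LinearIndependent ℝ b)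
    {c : Fin n → ℤ} {k : Fin n} (hk : c k ≠ 0) : ∑ i, c i • b i ≠ 0 := by
  intro h
  have := inner_dualBasis_sum_int hb c k
  rw [h, inner_zero_right] at this
  exact hk (by exact_mod_cast this.symm)

/-- Each Gram–Schmidt vector `b*ⱼ` of an HKZ-reduced basis is a shortest vector of the lattice
projected along the vectors before it. -/
theorem IsHKZ.norm_gramSchmidt_le {n : ℕ} {b : Fin n → Vec d} (hb : LinearIndependent ℝ b)
    (h : IsHKZ b) {j k : Fin n} (hjk : j ≤ k) {c : Fin n → ℤ} (hc : c k ≠ 0) :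
    ‖gramSchmidt ℝ b j‖ ≤ ‖∑ i, c i • b i‖ := by
  match n, b, h with
  | 0, _, _ => exact j.elim0
  | 1, b, _ =>
    obtain rfl : j = 0 := Subsingleton.elim _ _
    obtain rfl : k = 0 := Subsingleton.elim _ _
    rw [gramSchmidt_fin_zero, Fin.sum_univ_one]
    exact norm_le_norm_zsmul hc
  | n + 2, b, h =>
    obtain ⟨hs, ht, -⟩ := h
    induction j using Fin.cases with
    | zero =>
      rw [gramSchmidt_fin_zero]
      exact hs.2.2 _ (mem_lattice_iff.2 ⟨c, rfl⟩) (sum_zsmul_ne_zero hb hc)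
    | succ j =>
      obtain ⟨k, rfl⟩ := Fin.exists_succ_eq.2 (Fin.pos_iff_ne_zero.1 ((Fin.succ_pos j).trans_le hjk))
      rw [← gramSchmidt_projTail]
      refine (IsHKZ.norm_gramSchmidt_le (linearIndependent_projTail hb) ht
        (Fin.succ_le_succ_iff.1 hjk) (c := fun i => c (Fin.succ i)) hc).trans ?_
      rw [← projPerp_lattice_sum]
      exact norm_projPerp_le _ _

theorem IsHKZ.abs_mu_le {n : ℕ} {b : Fin n → Vec d} (hb : LinearIndependent ℝ b)
    (h : IsHKZ b) {i j : Fin n} (hji : j < i) : |mu b i j| ≤ 1 / 2 := by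
  match n, b, h with
  | 0, _, _ => exact j.elim0
  | 1, b, _ => exact absurd hji (by omega)
  | n + 2, b, h =>
    obtain ⟨-, ht, hsz⟩ := h
    obtain ⟨i, rfl⟩ := Fin.exists_succ_eq.2 (Fin.pos_iff_ne_zero.1 ((Fin.zero_le j).trans_lt hji))
    induction j using Fin.cases with
    | zero =>
      have h0 : 0 < ‖b 0‖ ^ 2 := pow_pos (norm_pos_iff.2 (hb.ne_zero 0)) 2
      have := hsz i
      rw [real_inner_self_eq_norm_sq, abs_of_pos h0] at this
      rw [mu, gramSchmidt_fin_zero, real_inner_comm, abs_div, abs_of_pos h0, div_le_iff₀ h0]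
      exact this
    | succ j =>
      rw [← mu_projTail]
      exact IsHKZ.abs_mu_le (linearIndependent_projTail hb) ht (Fin.succ_lt_succ_iff.1 hji)

/-- The maximum of the norms of the Gram–Schmidt vectors up to the `k`-th; for an HKZ-reduced basis it
is a lower bound for the norms of the lattice vectors outside the span of the first `k - 1` basis
vectors, and takes the role of the successive minima. -/
noncomputable def runningMax {n : ℕ} (b : Fin n → Vec d) (k : Fin n) : ℝ :=
  (Finset.Iic k).sup' ⟨k, Finset.mem_Iic.2 le_rfl⟩ fun j => ‖gramSchmidt ℝ b j‖

theorem norm_gramSchmidt_le_runningMax {n : ℕ} (b : Fin n → Vec d) {j k : Fin n} (h : j ≤ k) :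
    ‖gramSchmidt ℝ b j‖ ≤ runningMax b k :=
  Finset.le_sup' (fun j => ‖gramSchmidt ℝ b j‖) (Finset.mem_Iic.2 h)

theorem runningMax_mono {n : ℕ} (b : Fin n → Vec d) {j k : Fin n} (h : j ≤ k) :
    runningMax b j ≤ runningMax b k :=
  Finset.sup'_le _ _ fun _ hl =>
    norm_gramSchmidt_le_runningMax b ((Finset.mem_Iic.1 hl).trans h)

theorem runningMax_pos {n : ℕ} {b : Fin n → Vec d} (hb : LinearIndependent ℝ b) (k : Fin n) :
    0 < runningMax b k :=
  (norm_pos_iff.2 (gramSchmidt_ne_zero (𝕜 := ℝ) k hb)).trans_le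
    (norm_gramSchmidt_le_runningMax b le_rfl)

theorem IsHKZ.norm_sq_le {n : ℕ} {b : Fin n → Vec d} (hb : LinearIndependent ℝ b)
    (h : IsHKZ b) (i : Fin n) : ‖b i‖ ^ 2 ≤ ((i : ℝ) + 4) / 4 * runningMax b i ^ 2 := by
  rw [norm_sq_eq]
  have h1 : ‖gramSchmidt ℝ b i‖ ^ 2 ≤ runningMax b i ^ 2 :=
    pow_le_pow_left₀ (norm_nonneg _) (norm_gramSchmidt_le_runningMax b le_rfl) 2
  have h2 : ∀ j ∈ Finset.Iio i,
      mu b i j ^ 2 * ‖gramSchmidt ℝ b j‖ ^ 2 ≤ 1 / 4 * runningMax b i ^ 2 := by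
    intro j hj
    have hj := Finset.mem_Iio.1 hj
    refine mul_le_mul ?_ (pow_le_pow_left₀ (norm_nonneg _)
      (norm_gramSchmidt_le_runningMax b hj.le) 2) (by positivity) (by norm_num)
    rw [← sq_abs]
    have := pow_le_pow_left₀ (abs_nonneg _) (h.abs_mu_le hb hj) 2
    linarith
  have h3 := Finset.sum_le_card_nsmul _ _ _ h2
  rw [Fin.card_Iio, nsmul_eq_mul] at h3
  linarith

/-- The argument of Minkowski's second theorem: if the `j`-th Gram–Schmidt direction is scaled by
`1 / runningMax b j`, all nonzero lattice vectors get norm at least `1`. -/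
theorem IsHKZ.prod_runningMax_le {m : ℕ} (hm : 0 < m) {b : Fin m → Vec d}
    (hb : LinearIndependent ℝ b) (h : IsHKZ b) :
    Real.sqrt Real.pi ^ m / Real.Gamma (m / 2 + 1) * ∏ i, runningMax b i ≤
      2 ^ m * ∏ i, ‖gramSchmidt ℝ b i‖ := by
  have h0 := fun i => gramSchmidt_ne_zero (𝕜 := ℝ) i hb
  have hM := runningMax_pos hb
  set A : Matrix (Fin m) (Fin m) ℝ :=
    Matrix.diagonal (fun j => ‖gramSchmidt ℝ b j‖ / runningMax b j) *
      (Matrix.of (mu b)).transpose with hA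
  have hdet : A.det = (∏ i, ‖gramSchmidt ℝ b i‖) / ∏ i, runningMax b i := by
    rw [hA, Matrix.det_mul, Matrix.det_transpose, det_mu b h0, Matrix.det_diagonal, mul_one,
      Finset.prod_div_distrib]
  have hg : 0 < ∏ i, ‖gramSchmidt ℝ b i‖ := Finset.prod_pos fun i _ => norm_pos_iff.2 (h0 i)
  have hMp : 0 < ∏ i, runningMax b i := Finset.prod_pos fun i _ => hM i
  have key := ball_volume_le_of_one_le hm A (by rw [hdet]; exact (div_pos hg hMp).ne') ?_
  · rwa [hdet, abs_of_pos (div_pos hg hMp), ← mul_div_assoc, le_div_iff₀ hMp] at key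
  intro x hx
  obtain ⟨k, hk, hmax⟩ : ∃ k, x k ≠ 0 ∧ ∀ i, k < i → x i = 0 := by
    obtain ⟨i₀, hi₀⟩ := Function.ne_iff.1 hx
    obtain ⟨k, hk, hmax⟩ := Finset.exists_max_image (Finset.univ.filter fun i => x i ≠ 0) id
      ⟨i₀, by simpa using hi₀⟩
    refine ⟨k, by simpa using hk, fun i hi => ?_⟩
    by_contra hne
    exact absurd (hmax i (by simpa using hne)) (not_le.2 hi)
  set y : Fin m → ℝ := fun j => ∑ i, mu b i j * x i with hy
  have hy0 : ∀ j, k < j → y j = 0 := fun j hj => Finset.sum_eq_zero fun i _ => by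
    rcases lt_or_ge i j with hij | hij
    · rw [mu_of_lt b hij, zero_mul]
    · rw [hmax i (hj.trans_le hij), Int.cast_zero, mul_zero]
  have hAx : ∀ j, (A.mulVec fun i => (x i : ℝ)) j =
      ‖gramSchmidt ℝ b j‖ / runningMax b j * y j := by
    intro j
    rw [hA, ← Matrix.mulVec_mulVec, Matrix.mulVec_diagonal]
    rfl
  have hw : ∑ i, x i • b i = ∑ j, y j • gramSchmidt ℝ b j := by
    simp_rw [hy, Finset.sum_smul]
    rw [Finset.sum_comm]
    refine Finset.sum_congr rfl fun i _ => ?_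
    conv_lhs => rw [eq_sum_mu b h0 i, ← Int.cast_smul_eq_zsmul ℝ, Finset.smul_sum]
    refine Finset.sum_congr rfl fun j _ => ?_
    rw [smul_smul, mul_comm]
  have hlow : runningMax b k ≤ ‖∑ i, x i • b i‖ :=
    Finset.sup'_le _ _ fun j hj => h.norm_gramSchmidt_le hb (Finset.mem_Iic.1 hj) hk
  have hlow2 : runningMax b k ^ 2 ≤ ∑ j, y j ^ 2 * ‖gramSchmidt ℝ b j‖ ^ 2 := by
    rw [← norm_sum_smul_gramSchmidt_sq, ← hw]
    exact pow_le_pow_left₀ (hM k).le hlow 2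
  calc (1 : ℝ) ≤ (∑ j, y j ^ 2 * ‖gramSchmidt ℝ b j‖ ^ 2) / runningMax b k ^ 2 := by
        rwa [le_div_iff₀ (pow_pos (hM k) 2), one_mul]
    _ = ∑ j, y j ^ 2 * ‖gramSchmidt ℝ b j‖ ^ 2 / runningMax b k ^ 2 := Finset.sum_div _ _ _
    _ ≤ ∑ j, (A.mulVec fun i => (x i : ℝ)) j ^ 2 := by
        refine Finset.sum_le_sum fun j _ => ?_
        rw [hAx, mul_pow, div_pow, mul_comm (y j ^ 2), mul_div_right_comm]
        rcases lt_or_ge k j with hj | hj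
        · rw [hy0 j hj]
          simp
        · have h1 := pow_pos (hM j) 2
          have h2 := pow_le_pow_left₀ (hM j).le (runningMax_mono b hj) 2
          gcongr

theorem prod_add_four_le (m : ℕ) : ∏ i : Fin m, ((i : ℝ) + 4) ≤ (m + 3).factorial := by
  rw [Fin.prod_univ_eq_prod_range (fun i => (i : ℝ) + 4)]
  induction m with
  | zero => norm_num [Nat.factorial]
  | succ m ih =>
    rw [Finset.prod_range_succ, show m + 1 + 3 = (m + 3) + 1 by ring, Nat.factorial_succ (m + 3),
      mul_comm]
    push_cast
    rw [show (m : ℝ) + 3 + 1 = m + 4 by ring]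
    gcongr

/-- The squared orthogonality defect of an HKZ-reduced basis. -/
theorem IsHKZ.prod_norm_sq_le {m : ℕ} (hm : 0 < m) {b : Fin m → Vec d}
    (hb : LinearIndependent ℝ b) (h : IsHKZ b) :
    ∏ i, ‖b i‖ ^ 2 ≤ 2 * ((m + 1).factorial * (m + 3).factorial) / (2 * Real.pi) ^ m *
      ∏ i, ‖gramSchmidt ℝ b i‖ ^ 2 := by
  have hG : (0 : ℝ) < Real.Gamma (m / 2 + 1) := Real.Gamma_pos_of_pos (by positivity)
  have hM0 : 0 ≤ ∏ i, runningMax b i := Finset.prod_nonneg fun i _ => (runningMax_pos hb i).le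
  have h1 : ∏ i, ‖b i‖ ^ 2 ≤ (m + 3).factorial / 4 ^ m * (∏ i, runningMax b i) ^ 2 := by
    calc ∏ i, ‖b i‖ ^ 2 ≤ ∏ i : Fin m, (((i : ℝ) + 4) / 4 * runningMax b i ^ 2) :=
          Finset.prod_le_prod (fun _ _ => by positivity) fun i _ => h.norm_sq_le hb i
      _ = (∏ i : Fin m, ((i : ℝ) + 4)) / 4 ^ m * (∏ i, runningMax b i) ^ 2 := by
          rw [Finset.prod_mul_distrib, Finset.prod_div_distrib, Finset.prod_pow]
          simp
      _ ≤ _ := by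
          gcongr
          exact prod_add_four_le m
  have h2 := h.prod_runningMax_le hm hb
  rw [div_mul_eq_mul_div, div_le_iff₀ hG] at h2
  have h3 := pow_le_pow_left₀ (mul_nonneg (by positivity) hM0) h2 2
  rw [mul_pow, ← pow_mul, mul_comm m 2, pow_mul, Real.sq_sqrt Real.pi_pos.le] at h3
  have h4 : (∏ i, runningMax b i) ^ 2 ≤ 4 ^ m * (∏ i, ‖gramSchmidt ℝ b i‖) ^ 2 *
      (2 * (m + 1).factorial / 2 ^ m) / Real.pi ^ m := by
    rw [le_div_iff₀ (pow_pos Real.pi_pos m), mul_comm]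
    refine h3.trans ?_
    rw [mul_pow, mul_pow, ← pow_mul, mul_comm m 2, pow_mul]
    norm_num only
    gcongr
    exact Gamma_half_add_one_sq_le m
  refine h1.trans ((mul_le_mul_of_nonneg_left h4 (by positivity)).trans (le_of_eq ?_))
  rw [Finset.prod_pow, mul_pow]
  field_simp

/-! ### The dual basis on which the enumeration is set up -/

theorem IsLLLReduced.norm_sq_le_two_mul {n : ℕ} {b : Fin n → Vec d} (h : IsLLLReduced b)
    {i j : Fin n} (hij : (j : ℕ) = (i : ℕ) + 1) :
    ‖gramSchmidt ℝ b i‖ ^ 2 ≤ 2 * ‖gramSchmidt ℝ b j‖ ^ 2 := by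
  have hlt : i < j := by rw [Fin.lt_def]; omega
  have h1 := h.2.2 i j hij
  have h2 : ‖gramSchmidt ℝ b j + mu b j i • gramSchmidt ℝ b i‖ ^ 2 =
      ‖gramSchmidt ℝ b j‖ ^ 2 + mu b j i ^ 2 * ‖gramSchmidt ℝ b i‖ ^ 2 := by
    have h3 : inner ℝ (gramSchmidt ℝ b j) (mu b j i • gramSchmidt ℝ b i) = (0 : ℝ) := by
      rw [inner_smul_right, gramSchmidt_orthogonal ℝ b hlt.ne', mul_zero]
    have := norm_add_sq_eq_norm_sq_add_norm_sq_real h3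
    rw [sq, this, norm_smul, Real.norm_eq_abs, ← sq_abs (mu b j i)]
    ring
  have h4 := pow_le_pow_left₀ (abs_nonneg _) (h.2.1 j i hlt) 2
  rw [sq_abs] at h4
  rw [Lovasz, h2] at h1
  nlinarith [sq_nonneg ‖gramSchmidt ℝ b i‖]

theorem sum_two_pow_sub_le (n : ℕ) : ∑ j ∈ Finset.range n, (2 : ℝ) ^ (n - j) ≤ 2 ^ (n + 1) := by
  induction n with
  | zero => simp
  | succ n ih =>
    rw [Finset.sum_range_succ']
    simp only [Nat.add_sub_add_right, Nat.sub_zero]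
    rw [pow_succ 2 (n + 1)]
    linarith

/-- By Lovász' condition the squared Gram–Schmidt norms at most halve from one index to the next, so
that the last vector of an LLL-reduced basis is not much longer than its Gram–Schmidt vector. -/
theorem IsLLLReduced.norm_last_sq_le {n : ℕ} {b : Fin (n + 1) → Vec d} (h : IsLLLReduced b) :
    ‖b (Fin.last n)‖ ^ 2 ≤ 2 ^ (n + 1) * ‖gramSchmidt ℝ b (Fin.last n)‖ ^ 2 := by
  set G := ‖gramSchmidt ℝ b (Fin.last n)‖ ^ 2 with hG
  have hG0 : 0 ≤ G := sq_nonneg _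
  have key : ∀ t i : ℕ, ∀ hi : i < n + 1, i + t = n → ‖gramSchmidt ℝ b ⟨i, hi⟩‖ ^ 2 ≤ 2 ^ t * G := by
    intro t
    induction t with
    | zero =>
      rintro i hi hit
      obtain rfl : i = n := by omega
      rw [pow_zero, one_mul]
      exact le_rfl
    | succ t ih =>
      intro i hi hit
      have h1 := h.norm_sq_le_two_mul (i := ⟨i, hi⟩) (j := ⟨i + 1, by omega⟩) rfl
      have h2 := ih (i + 1) (by omega) (by omega)
      rw [pow_succ (2 : ℝ) t]
      linarith
  rw [norm_sq_eq]
  have hsum : ∑ j ∈ Finset.Iio (Fin.last n), mu b (Fin.last n) j ^ 2 * ‖gramSchmidt ℝ b j‖ ^ 2 ≤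
      1 / 4 * (2 ^ (n + 1) * G) := by
    have hI : Finset.Iio (Fin.last n) = Finset.univ.map Fin.castSuccEmb := by
      ext j
      simp only [Finset.mem_Iio, Finset.mem_map, Finset.mem_univ, true_and]
      constructor
      · intro hj
        exact ⟨j.castPred hj.ne, by simp⟩
      · rintro ⟨j, rfl⟩
        exact Fin.castSucc_lt_last j
    rw [hI, Finset.sum_map]
    calc _ ≤ ∑ j : Fin n, 1 / 4 * (2 ^ (n - (j : ℕ)) * G) := by
          refine Finset.sum_le_sum fun j _ => ?_
          refine mul_le_mul ?_ (key _ j (by omega) (by omega)) (sq_nonneg _) (by norm_num)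
          have := pow_le_pow_left₀ (abs_nonneg _) (h.2.1 _ _ (Fin.castSucc_lt_last j)) 2
          rw [sq_abs] at this
          exact this.trans (by norm_num)
      _ = 1 / 4 * ((∑ j ∈ Finset.range n, (2 : ℝ) ^ (n - j)) * G) := by
          rw [Fin.sum_univ_eq_sum_range (fun j => 1 / 4 * ((2 : ℝ) ^ (n - j) * G)),
            ← Finset.mul_sum, Finset.sum_mul]
      _ ≤ _ := by
          gcongr
          exact sum_two_pow_sub_le n
  have h2 : (2 : ℝ) ≤ 2 ^ (n + 1) := by
    rw [pow_succ]
    linarith [one_le_pow₀ (show (1 : ℝ) ≤ 2 by norm_num) (n := n)]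
  nlinarith [mul_le_mul_of_nonneg_right h2 hG0]

section Snoc

variable {n : ℕ} (e : Fin n → Vec d) (x : Vec d)

theorem gramSchmidt_snoc_castSucc (i : Fin n) :
    gramSchmidt ℝ (Fin.snoc (α := fun _ => Vec d) e x) (Fin.castSucc i) = gramSchmidt ℝ e i := by
  apply gramSchmidt_congr
  · congr 1
    ext y
    constructor
    · rintro ⟨j, hj, rfl⟩
      exact ⟨Fin.castSucc j, Fin.castSucc_lt_castSucc_iff.2 hj, by simp⟩
    · rintro ⟨j, hj, rfl⟩
      have hj' : j < Fin.castSucc i := hj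
      obtain ⟨j, rfl⟩ := Fin.exists_castSucc_eq.2 (hj'.trans (Fin.castSucc_lt_last i)).ne
      exact ⟨j, Fin.castSucc_lt_castSucc_iff.1 hj', by simp⟩
  · simp

theorem image_Iio_last (c : Fin (n + 1) → Vec d) :
    c '' Set.Iio (Fin.last n) = Set.range fun i => c (Fin.castSucc i) := by
  ext y
  constructor
  · rintro ⟨j, hj, rfl⟩
    obtain ⟨j, rfl⟩ := Fin.exists_castSucc_eq.2 (ne_of_lt hj)
    exact ⟨j, rfl⟩
  · rintro ⟨j, rfl⟩
    exact ⟨_, Fin.castSucc_lt_last j, rfl⟩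

theorem gramSchmidt_snoc_last {c : Fin (n + 1) → Vec d} {e : Fin n → Vec d}
    (he : lattice e = lattice fun i => c (Fin.castSucc i)) :
    gramSchmidt ℝ (Fin.snoc (α := fun _ => Vec d) e (c (Fin.last n))) (Fin.last n) =
      gramSchmidt ℝ c (Fin.last n) := by
  apply gramSchmidt_congr
  · rw [image_Iio_last, image_Iio_last]
    simp only [Fin.snoc_castSucc]
    exact (span_eq_of_lattice_eq he).symm
  · simp

end Snoc

/-- The squared orthogonality defect of the dual of a basis on which the enumeration runs. -/
theorem prod_norm_sq_snoc_le {m : ℕ} (hm : 0 < m) {c : Fin (m + 1) → Vec d} {e : Fin m → Vec d}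
    (hc : IsLLLReduced c) (he : LinearIndependent ℝ e) (hez : IsHKZ e)
    (hel : lattice e = lattice fun i => c (Fin.castSucc i)) :
    ∏ i, ‖(Fin.snoc (α := fun _ => Vec d) e (c (Fin.last m))) i‖ ^ 2 ≤
      4 * Real.pi * ((m + 1).factorial * (m + 3).factorial) / Real.pi ^ (m + 1) *
        latticeDet (Fin.snoc (α := fun _ => Vec d) e (c (Fin.last m))) ^ 2 := by
  rw [latticeDet_eq _ (linearIndependent_snoc hc.1 hel), ← Finset.prod_pow,
    Fin.prod_univ_castSucc, Fin.prod_univ_castSucc]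
  simp only [Fin.snoc_castSucc, Fin.snoc_last, gramSchmidt_snoc_castSucc,
    gramSchmidt_snoc_last hel]
  refine (mul_le_mul (hez.prod_norm_sq_le hm he) hc.norm_last_sq_le (sq_nonneg _)
    (by positivity)).trans (le_of_eq ?_)
  rw [mul_pow, pow_succ 2 m, pow_succ Real.pi m]
  field_simp
  ring

/-! ### The number of qubits -/

/-- Stirling's upper bound for the factorial, squared. -/
theorem factorial_sq_le {k : ℕ} (hk : 0 < k) :
    ((k.factorial : ℝ)) ^ 2 ≤ Real.exp 1 ^ 2 * k * ((k / Real.exp 1) ^ k) ^ 2 := by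
  obtain ⟨n, rfl⟩ : ∃ n, k = n + 1 := ⟨k - 1, by omega⟩
  have h := Stirling.stirlingSeq'_antitone (Nat.zero_le n)
  simp only [Function.comp_apply, Nat.succ_eq_add_one, zero_add, Stirling.stirlingSeq_one] at h
  rw [Stirling.stirlingSeq, div_le_iff₀ (by positivity)] at h
  have h2 := pow_le_pow_left₀ (by positivity) h 2
  refine h2.trans (le_of_eq ?_)
  rw [mul_pow, mul_pow, div_pow, Real.sq_sqrt (by norm_num), Real.sq_sqrt (by positivity)]
  ring

theorem factorial_mul_factorial_le {k : ℕ} (hk : 2 ≤ k) :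
    4 * Real.pi * (k.factorial * (k + 2).factorial) ≤
      ((k / Real.exp 1) ^ k) ^ 2 * (k : ℝ) ^ 13 := by
  have hk' : (2 : ℝ) ≤ k := by exact_mod_cast hk
  have h1 := factorial_sq_le (show 0 < k by omega)
  have h2 : (((k + 2).factorial : ℕ) : ℝ) = (k + 2) * (k + 1) * k.factorial := by
    rw [Nat.factorial_succ, Nat.factorial_succ]
    push_cast
    ring
  have h3 : ((k : ℝ) + 2) * (k + 1) ≤ 6 * k ^ 2 := by nlinarith
  have h4 : 24 * Real.pi * Real.exp 1 ^ 2 ≤ (k : ℝ) ^ 10 := by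
    have h5 : Real.exp 1 ^ 2 ≤ 7.5 :=
      (pow_le_pow_left₀ (Real.exp_pos 1).le Real.exp_one_lt_d9.le 2).trans (by norm_num)
    have h6 := pow_le_pow_left₀ (by norm_num) hk' 10
    nlinarith [Real.pi_lt_d2, Real.pi_pos]
  calc 4 * Real.pi * (k.factorial * (k + 2).factorial)
      = 4 * Real.pi * (((k : ℝ) + 2) * (k + 1)) * (k.factorial : ℝ) ^ 2 := by rw [h2]; ring
    _ ≤ 4 * Real.pi * (6 * k ^ 2) * (Real.exp 1 ^ 2 * k * ((k / Real.exp 1) ^ k) ^ 2) := by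
        gcongr
    _ = 24 * Real.pi * Real.exp 1 ^ 2 * (k ^ 3 * ((k / Real.exp 1) ^ k) ^ 2) := by ring
    _ ≤ (k : ℝ) ^ 10 * (k ^ 3 * ((k / Real.exp 1) ^ k) ^ 2) := by gcongr
    _ = _ := by ring

/-- The bounds of the enumeration on the dual of a basis `g` involve only `g` and the volume. -/
theorem numQubits_dualBasis_le {C : ℝ} (hC : 0 < C) {k : ℕ} (hk : 0 < k) {g : Fin k → Vec d}
    (hg : LinearIndependent ℝ g) :
    (numQubits C (dualBasis g) : ℝ) ≤ k * (2 + Real.logb 2 C) +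
      k / 2 * (Real.logb 2 k - 1 - Real.logb 2 Real.pi - Real.logb 2 (Real.exp 1)) -
      Real.logb 2 (latticeDet g) + 1 / 2 * Real.logb 2 (∏ i, ‖g i‖ ^ 2) := by
  have hk0 : (0 : ℝ) < k := by exact_mod_cast hk
  have hdet : 0 < latticeDet g := Real.sqrt_pos.2 (det_gram_pos hg)
  have hs : 0 < Real.sqrt ((k : ℝ) / (2 * Real.pi * Real.exp 1)) :=
    Real.sqrt_pos.2 (by positivity)
  have hp : 0 < (latticeDet g)⁻¹ ^ ((1 : ℝ) / k) := Real.rpow_pos_of_pos (inv_pos.2 hdet) _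
  have hgh : gh (dualBasis g) = Real.sqrt ((k : ℝ) / (2 * Real.pi * Real.exp 1)) *
      (latticeDet g)⁻¹ ^ ((1 : ℝ) / k) := by rw [gh, latticeDet_dualBasis hg]
  have hgh0 : 0 < gh (dualBasis g) := by rw [hgh]; positivity
  have hlog : Real.logb 2 (gh (dualBasis g)) =
      1 / 2 * (Real.logb 2 k - 1 - Real.logb 2 Real.pi - Real.logb 2 (Real.exp 1)) -
        1 / k * Real.logb 2 (latticeDet g) := by
    rw [hgh, Real.logb_mul hs.ne' hp.ne', Real.logb_rpow_eq_mul_logb_of_pos (inv_pos.2 hdet),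
      Real.logb_inv, Real.sqrt_eq_rpow, Real.logb_rpow_eq_mul_logb_of_pos (by positivity),
      Real.logb_div hk0.ne' (by positivity), Real.logb_mul (by positivity) (Real.exp_pos 1).ne',
      Real.logb_mul (by norm_num) Real.pi_pos.ne', Real.logb_self_eq_one (by norm_num)]
    ring
  have hterm : ∀ i, ((⌊Real.logb 2 (2 * coeffBound C (dualBasis g) i)⌋ + 1 : ℤ) : ℝ) ≤
      2 + Real.logb 2 C + Real.logb 2 (gh (dualBasis g)) + Real.logb 2 ‖g i‖ := by
    intro i
    have hn : ‖g i‖ ≠ 0 := norm_ne_zero_iff.2 (hg.ne_zero i)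
    have h1 := Int.floor_le (Real.logb 2 (2 * coeffBound C (dualBasis g) i))
    rw [coeffBound, dualBasis_dualBasis hg] at h1 ⊢
    rw [Real.logb_mul (by norm_num) (by positivity), Real.logb_mul (by positivity) hn,
      Real.logb_mul hC.ne' hgh0.ne', Real.logb_self_eq_one (by norm_num)] at h1
    rw [Real.logb_mul (by norm_num) (by positivity), Real.logb_mul (by positivity) hn,
      Real.logb_mul hC.ne' hgh0.ne', Real.logb_self_eq_one (by norm_num)]
    push_cast
    linarith
  have hprod : ∑ i, Real.logb 2 ‖g i‖ = 1 / 2 * Real.logb 2 (∏ i, ‖g i‖ ^ 2) := by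
    rw [Finset.prod_pow, Real.logb_pow, Real.logb_prod]
    · ring
    · exact fun i _ => norm_ne_zero_iff.2 (hg.ne_zero i)
  rw [numQubits]
  push_cast
  have hsum := Finset.sum_le_sum fun i (_ : i ∈ Finset.univ) => hterm i
  push_cast at hsum
  refine hsum.trans (le_of_eq ?_)
  rw [Finset.sum_add_distrib, hprod, hlog, Finset.sum_const, Finset.card_univ, Fintype.card_fin,
    nsmul_eq_mul]
  field_simp
  ring

theorem three_le_logb_pi_add_logb_exp :
    3 ≤ Real.logb 2 Real.pi + Real.logb 2 (Real.exp 1) := by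
  rw [← Real.logb_mul Real.pi_pos.ne' (Real.exp_pos 1).ne',
    Real.le_logb_iff_rpow_le (by norm_num) (by positivity)]
  have h1 := Real.pi_gt_d2
  have h2 := Real.exp_one_gt_d9
  norm_num
  nlinarith

theorem le_half_logb_pi_add_logb_exp :
    2.26 ≤ 1 / 2 * Real.logb 2 Real.pi + Real.logb 2 (Real.exp 1) := by
  have h2 := Real.log_two_lt_d9
  have h2' : 0 < Real.log 2 := Real.log_pos (by norm_num)
  -- `log π ≥ 1 + (1 - e / π)`, since `log x ≥ 1 - 1 / x`
  have hpi : 1.1333 ≤ Real.log Real.pi := by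
    have h3 := Real.one_sub_inv_le_log_of_pos (show 0 < Real.pi / Real.exp 1 by positivity)
    rw [Real.log_div Real.pi_pos.ne' (Real.exp_pos 1).ne', Real.log_exp, inv_div] at h3
    have h4 : Real.exp 1 / Real.pi ≤ 0.8667 := by
      rw [div_le_iff₀ Real.pi_pos]
      nlinarith [Real.pi_gt_d4, Real.exp_one_lt_d9]
    linarith
  rw [Real.logb, Real.logb, Real.log_exp, ← mul_div_assoc, ← add_div, le_div_iff₀ h2']
  nlinarith

/-- The number of qubits in rank `k`, from a bound for the orthogonality defect of the dual basis. The
factor `2^(k/2)` that LLL-reduction loses on the last vector of the dual basis is absorbed because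
`π e ≥ 8`. -/
theorem numQubits_dualBasis_le_of_prod_le {C : ℝ} (hC : 0 < C) {k : ℕ} (hk : 2 ≤ k)
    {g : Fin k → Vec d} (hg : LinearIndependent ℝ g)
    (hD : ∏ i, ‖g i‖ ^ 2 ≤ 4 * Real.pi * (k.factorial * (k + 2).factorial) / Real.pi ^ k *
      latticeDet g ^ 2) :
    (numQubits C (dualBasis g) : ℝ) ≤ 3 / 2 * k * Real.logb 2 k -
      (1 / 2 * Real.logb 2 Real.pi + Real.logb 2 (Real.exp 1) - Real.logb 2 C) * k +
      13 / 2 * Real.logb 2 k := by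
  have hN := numQubits_dualBasis_le hC (show 0 < k by omega) hg
  have hF := factorial_mul_factorial_le hk
  have hk0 : (0 : ℝ) < k := by exact_mod_cast (show 0 < k by omega)
  have hdet : 0 < latticeDet g := Real.sqrt_pos.2 (det_gram_pos hg)
  have hgp : 0 < ∏ i, ‖g i‖ ^ 2 :=
    Finset.prod_pos fun i _ => pow_pos (norm_pos_iff.2 (hg.ne_zero i)) 2
  have hD' : ∏ i, ‖g i‖ ^ 2 ≤
      ((k / Real.exp 1) ^ k) ^ 2 * (k : ℝ) ^ 13 / Real.pi ^ k * latticeDet g ^ 2 := by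
    refine hD.trans ?_
    gcongr
  have hlog := Real.logb_le_logb_of_le (show (1 : ℝ) < 2 by norm_num) hgp hD'
  rw [Real.logb_mul (by positivity) (by positivity), Real.logb_div (by positivity) (by positivity),
    Real.logb_mul (by positivity) (by positivity), Real.logb_pow, Real.logb_pow, Real.logb_pow,
    Real.logb_pow, Real.logb_pow, Real.logb_div hk0.ne' (Real.exp_pos 1).ne'] at hlog
  push_cast at hlog
  have hpe := mul_le_mul_of_nonneg_left three_le_logb_pi_add_logb_exp hk0.le
  linarith

/-- The main terms of the bound increase with the rank, except where the rank is bounded in terms of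
`c`; the last summand makes up for this. -/
theorem le_mul_logb_of_le {c x y : ℝ} (hx : 2 ≤ x) (hxy : x ≤ y) :
    3 / 2 * x * Real.logb 2 x - c * x ≤
      3 / 2 * y * Real.logb 2 y - c * y + |c| * 2 ^ (2 / 3 * c) * Real.logb 2 y := by
  have hx0 : 0 < x := by linarith
  have hy0 : 0 < y := by linarith
  have h1 : Real.logb 2 x ≤ Real.logb 2 y := Real.logb_le_logb_of_le (by norm_num) hx0 hxy
  have h2 : 1 ≤ Real.logb 2 y := by
    rw [Real.le_logb_iff_rpow_le (by norm_num) hy0, Real.rpow_one]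
    linarith
  have h3 : 0 ≤ |c| * 2 ^ (2 / 3 * c) := by positivity
  have h4 : 3 / 2 * x * Real.logb 2 x ≤ 3 / 2 * x * Real.logb 2 y := by gcongr
  rcases le_or_gt c (3 / 2 * Real.logb 2 y) with hc | hc
  · nlinarith [mul_nonneg (sub_nonneg.2 hxy) (sub_nonneg.2 hc)]
  · -- here `y` is bounded in terms of `c`
    have h5 : y ≤ 2 ^ (2 / 3 * c) := by
      rw [← Real.logb_le_iff_le_rpow (by norm_num) hy0]
      linarith
    have hc0 : 0 < c := by linarith
    rw [abs_of_pos hc0] at h3 ⊢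
    have h6 : c * (y - x) ≤ c * 2 ^ (2 / 3 * c) := by
      apply mul_le_mul_of_nonneg_left _ hc0.le
      linarith
    have h7 : 0 ≤ (y - x) * Real.logb 2 y := mul_nonneg (by linarith) (by linarith)
    nlinarith

/-- Every enumeration of a run works on the dual of a basis that is HKZ-reduced up to its last vector,
which comes from an LLL-reduced basis. -/
theorem HKZRun.exists_of_mem_calls {C : ℝ} {n : ℕ} {b out : Fin n → Vec d}
    {calls : List ((k : ℕ) × (Fin k → Vec d))} (h : HKZRun C b out calls)
    (hb : LinearIndependent ℝ b) (hG : ∀ c ∈ calls, GaussianHeuristic C c.2) :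
    ∀ c ∈ calls, ∃ (m : ℕ) (a : Fin (m + 1) → Vec d) (e : Fin m → Vec d),
      0 < m ∧ m + 1 ≤ n ∧ IsLLLReduced a ∧ LinearIndependent ℝ e ∧ IsHKZ e ∧
      (lattice e = lattice fun i => a (Fin.castSucc i)) ∧
      c = ⟨m + 1, dualBasis (Fin.snoc (α := fun _ => Vec d) e (a (Fin.last m)))⟩ := by
  induction h with
  | base b => exact fun c hc => absurd hc List.not_mem_nil
  | step b d₁ b₁ b₂ out e f v α calls₁ calls₂ hd hrun₁ hb₁ hv hb₂ hrun₂ h₀ hα ih₁ ih₂ =>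
    have hd₁ := hd.isLLLReduced
    have hdc := hd₁.1.comp _ (Fin.castSucc_injective _)
    have hG₁ : ∀ c ∈ calls₁, GaussianHeuristic C c.2 := fun c hc => hG c (by simp [hc])
    obtain ⟨he, hel⟩ := hrun₁.isBasis hdc
    intro c hc
    rcases List.mem_append.1 hc with hc | hc
    · obtain ⟨m, a, e', hm, hmn, h⟩ := ih₁ hdc hG₁ c hc
      exact ⟨m, a, e', hm, by omega, h⟩
    rcases List.mem_cons.1 hc with rfl | hc
    · exact ⟨_, d₁, e, Nat.succ_pos _, le_rfl, hd₁, he, hrun₁.isHKZ hdc hG₁, hel, by rw [hb₁]⟩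
    · obtain ⟨m, a, e', hm, hmn, h⟩ := ih₂ (linearIndependent_projTail hb₂.isLLLReduced.1)
        (fun c hc => hG c (by simp [hc])) c hc
      exact ⟨m, a, e', hm, by omega, h⟩

theorem HKZRun.numQubits_le {C : ℝ} (hC : 0 < C) {n : ℕ} {b out : Fin n → Vec d}
    {calls : List ((k : ℕ) × (Fin k → Vec d))} (h : HKZRun C b out calls)
    (hb : LinearIndependent ℝ b) (hG : ∀ c ∈ calls, GaussianHeuristic C c.2)
    {γ : ℝ} (hγ : γ = 1 / 2 * Real.logb 2 Real.pi + Real.logb 2 (Real.exp 1) - Real.logb 2 C)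
    {c : (k : ℕ) × (Fin k → Vec d)} (hc : c ∈ calls) :
    (numQubits C c.2 : ℝ) ≤ 3 / 2 * n * Real.logb 2 n - γ * n +
      (13 / 2 + |γ| * 2 ^ (2 / 3 * γ)) * Real.logb 2 n := by
  obtain ⟨m, a, e, hm, hmn, ha, he, hez, hel, rfl⟩ := h.exists_of_mem_calls hb hG c hc
  have h1 := numQubits_dualBasis_le_of_prod_le hC (show 2 ≤ m + 1 by omega)
    (linearIndependent_snoc ha.1 hel) (prod_norm_sq_snoc_le hm ha he hez hel)
  rw [← hγ] at h1
  have h2 : (2 : ℝ) ≤ (m + 1 : ℕ) := by exact_mod_cast (show 2 ≤ m + 1 by omega)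
  have h3 : ((m + 1 : ℕ) : ℝ) ≤ n := by exact_mod_cast hmn
  have h4 := le_mul_logb_of_le (c := γ) h2 h3
  have h5 : Real.logb 2 (m + 1 : ℕ) ≤ Real.logb 2 n :=
    Real.logb_le_logb_of_le (by norm_num) (by linarith) h3
  linarith

end QuantumHKZ

theorem mainTheorem1 (C : ℝ) (hC : 0 < C) :
    (∀ (d n : ℕ) (b : Fin n → QuantumHKZ.Vec d), 1 ≤ n → LinearIndependent ℝ b →
      ∃ out calls, QuantumHKZ.HKZRun C b out calls) ∧
    (∀ (d n : ℕ) (b out : Fin n → QuantumHKZ.Vec d)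
        (calls : List ((k : ℕ) × (Fin k → QuantumHKZ.Vec d))),
      1 ≤ n → LinearIndependent ℝ b → QuantumHKZ.HKZRun C b out calls →
      (∀ c ∈ calls, QuantumHKZ.GaussianHeuristic C c.2) →
      LinearIndependent ℝ out ∧ QuantumHKZ.lattice out = QuantumHKZ.lattice b ∧
        QuantumHKZ.IsHKZ out) ∧
    ∃ K : ℝ, ∀ (d n : ℕ) (b out : Fin n → QuantumHKZ.Vec d)
        (calls : List ((k : ℕ) × (Fin k → QuantumHKZ.Vec d))),
      1 ≤ n → LinearIndependent ℝ b → QuantumHKZ.HKZRun C b out calls →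
      (∀ c ∈ calls, QuantumHKZ.GaussianHeuristic C c.2) →
      ∀ c ∈ calls,
        (QuantumHKZ.numQubits C c.2 : ℝ) ≤
            3 / 2 * n * Real.logb 2 n
              - (1 / 2 * Real.logb 2 Real.pi + Real.logb 2 (Real.exp 1) - Real.logb 2 C) * n
              + K * Real.logb 2 n ∧
        (C = 1 →
          (QuantumHKZ.numQubits C c.2 : ℝ) ≤
            3 / 2 * n * Real.logb 2 n - 2.26 * n + K * Real.logb 2 n) ∧
        ((∀ i, 1 / 4 ≤ QuantumHKZ.coeffBound C c.2 i) →
          (QuantumHKZ.registerSize C c.2 : ℝ) ≤ QuantumHKZ.numQubits C c.2) := by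
  obtain ⟨γ, hγ⟩ : ∃ γ : ℝ,
    γ = 1 / 2 * Real.logb 2 Real.pi + Real.logb 2 (Real.exp 1) - Real.logb 2 C := ⟨_, rfl⟩
  refine ⟨fun d n b hn hb => ?_, fun d n b out calls _ hb h hG => ?_,
    13 / 2 + |γ| * 2 ^ (2 / 3 * γ), fun d n b out calls _ hb h hG c hc => ?_⟩
  · obtain ⟨n, rfl⟩ : ∃ n', n = n' + 1 := ⟨n - 1, by omega⟩
    exact QuantumHKZ.exists_hkzRun C n b hb
  · exact ⟨(h.isBasis hb).1, (h.isBasis hb).2, h.isHKZ hb hG⟩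
  · have hN := h.numQubits_le hC hb hG hγ hc
    refine ⟨by rwa [hγ] at hN ⊢, fun hC1 => ?_, QuantumHKZ.registerSize_le_numQubits⟩
    have h226 : 2.26 ≤ γ := by
      rw [hγ, hC1, Real.logb_one, sub_zero]
      exact QuantumHKZ.le_half_logb_pi_add_logb_exp
    have := mul_le_mul_of_nonneg_right h226 (Nat.cast_nonneg n : (0 : ℝ) ≤ n)
    linarith
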